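/- Red-green calculus. A diagram is a finite undirected open graph (parallel edges, loops and bare wires allowed) whose vertices are green ($Z$) or red ($X$) spiders of any degree, each with a phase $\alpha\in\mathbb R/2\pi\mathbb Z$ (phase $0$ if not mentioned), and degree-two vertices $H$. Write $p_Z(\alpha),p_X(\alpha)$ for the green/red spider of phase $\alpha$ with two legs. Equations between diagrams with the same open ends may be applied inside any larger diagram. The axioms are the following, and the same with the colours exchanged. (Spider law) A connected diagram with spiders of one colour only equals the single spider of that colour with the same open ends and the sum of the phases; a spider of phase $0$ with two legs is a plain wire. (Copying) A red vertex of degree one joined to a green vertex of degree three equals two red vertices of degree one. (Bialgebra) The alternating $4$-cycle of two red and two green vertices of degree three, with open ends $a,b$ at the red and $c,d$ at the green vertices, equals a green vertex with open ends $a,b$ joined by one wire to a red vertex with open ends $c,d$. ($\pi$-commutation) A red vertex of degree three with $p_Z(\pi)$ on two of its legs equals the same vertex with $p_Z(\pi)$ on the third leg instead; $p_Z(\pi)$ followed by a red vertex of degree one equals that vertex. (Equations for $H$) $H\circ H=\mathrm{id}$; $H$ on one leg of a red vertex of degree three equals a green vertex of degree three with $H$ on the two other legs; $H$ on a red vertex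 of degree one equals a green vertex of degree one; $p_X(\alpha)\circ H=H\circ p_Z(\alpha)$ for all $\alpha$. (Scalars are suppressed) The following diagrams without open ends equal the empty diagram: a vertex without legs of phase $\alpha\ne\pi$; a vertex of degree one and phase $\alpha$ joined to a vertex of degree one of the other colour and of phase $0$ or $\pi$. Graph states. For a finite simple graph $G$, the diagram $|G\rangle$ has one green vertex of phase $0$ for each vertex of $G$, with one output wire at each of them, and two green vertices are connected through an $H$ if and only if the corresponding vertices of $G$ are adjacent. For $u\in V(G)$ let $N_G(u)$ be the set of neighbours of $u$, and let $G*u$ be the graph on $V(G)$ in which two distinct vertices $v,w$ are adjacent if and only if exactly one of "$vw\in E(G)$" and "$v,w\in N_G(u)$" holds. For an angle $\theta$, the local complementation property $\mathrm{LC}(\theta)$ (Van den Nest's theorem) is the family of equations, over all finite simple graphs $G$ and all $u\in V(G)$, \[ R_x(\theta)^{(u)}\,R_z(-\theta)^{(N_G(u))}\,|G\rangle=|G*u\rangle, \] where $p_X(\theta)$ is attached to the output wire of $u$ and $p_Z(-\theta)$ to the output wire of every neighbour of $u$. Theorem. Let $E$ be any set of equations between diagrams, and consider the red-green calculus with the equations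 in $E$ as additional axioms. For $\theta=-\pi/2$, and likewise for $\theta=\pi/2$, all equations of $\mathrm{LC}(\theta)$ are derivable if and only if the Euler decomposition \[ H=p_Z(-\pi/2)\circ p_X(-\pi/2)\circ p_Z(-\pi/2) \] is derivable. In particular, adding $\mathrm{LC}(\theta)$ to the axioms makes the Euler decomposition derivable, and adding the Euler decomposition makes $\mathrm{LC}(\theta)$ derivable. -/

import Mathlib

/-!
# The red-green calculus

A diagram is a finite undirected open graph. It is given here by its list of vertices, each with
the unordered list of the wires at its legs. A wire that occurs twice joins two legs; a wire that
occurs once is an open end (an input or an output) of the diagram.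
-/

namespace RedGreen

/-- The two families of vertices: green (`Z`) and red (`X`). -/
inductive Colour
  | green
  | red

/-- The other colour. -/
def Colour.swap : Colour → Colour
  | .green => .red
  | .red => .green

/-- Kinds of vertices. A spider has a colour, a phase `α` (mod `2π`) and any number of legs:
`δ` and `δ†` are the spiders of phase `0` with three legs, `ε` and `ε†` the spiders of phase `0`
with one leg, and `p(α)` is the spider of phase `α` with two legs. `line` is not a vertex proper
but a plain piece of wire, needed to draw a bare wire between two open ends (the identity, the cup
and the cap) and to connect two open ends of a diagram. -/
inductive Kind
  | spider (c : Colour) (α : Real.Angle)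
  | had
  | line

/-- A vertex, with the wires attached to its legs. Legs are unordered, as graphs are undirected. -/
structure Vertex (W : Type) where
  kind : Kind
  legs : Multiset W

/-- The vertex of the given colour and phase on the given wires. -/
def spider {W : Type} (c : Colour) (α : Real.Angle) (S : Multiset W) : Vertex W :=
  ⟨.spider c α, S⟩

/-- The vertex `H` between the wires `x` and `y`. -/
def had {W : Type} (x y : W) : Vertex W := ⟨.had, {x, y}⟩

/-- A plain piece of wire that joins `x` and `y`. -/
def line {W : Type} (x y : W) : Vertex W := ⟨.line, {x, y}⟩

/-- Collections of vertices; juxtaposition is `+`, and shared wires are connected. -/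
abbrev Net (W : Type) := Multiset (Vertex W)

/-- Renaming of wires. -/
def Net.rename {W W' : Type} (f : W → W') (D : Net W) : Net W' :=
  D.map fun v => ⟨v.kind, v.legs.map f⟩

/-- The number of legs attached to the wire `x`. -/
def Net.deg (D : Net ℕ) (x : ℕ) : ℕ := (D.map fun v => v.legs.count x).sum

/-- A net is a diagram if every wire has at most two ends at legs, and every `H` and every piece
of wire has exactly two ends. -/
def Net.IsDiagram (D : Net ℕ) : Prop :=
  (∀ x, D.deg x ≤ 2) ∧ ∀ v ∈ D, v.kind = .had ∨ v.kind = .line → v.legs.card = 2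

/-- An equation between two diagrams with the same open ends. -/
structure Equation where
  lhs : Net ℕ
  rhs : Net ℕ
  lhs_isDiagram : lhs.IsDiagram
  rhs_isDiagram : rhs.IsDiagram
  same_open : ∀ x, lhs.deg x = 1 ↔ rhs.deg x = 1

/-- The real number `θ` as a phase, that is, modulo `2π`. -/
noncomputable def ang (θ : ℝ) : Real.Angle := (θ : Real.Angle)

/-- The axioms of the red-green calculus, each for both colours. -/
inductive Ax : Net ℕ → Net ℕ → Prop
  /- A piece of wire can be absorbed by whatever it is attached to. -/
  | absorb (k : Kind) (x y : ℕ) (S : Multiset ℕ) :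
      Ax {⟨k, x ::ₘ S⟩, line x y} {⟨k, y ::ₘ S⟩}
  /- Spider law: a connected diagram of one colour is the single spider of that colour with the
  same open ends and the sum of the phases (merge along an edge; remove an edge that
  has become a loop), and the spider of phase `0` with two legs is a plain wire. -/
  | fuse (c : Colour) (α β : Real.Angle) (w : ℕ) (S T : Multiset ℕ) :
      Ax {spider c α (w ::ₘ S), spider c β (w ::ₘ T)} {spider c (α + β) (S + T)}
  | loop (c : Colour) (α : Real.Angle) (w : ℕ) (S : Multiset ℕ) :
      Ax {spider c α (w ::ₘ w ::ₘ S)} {spider c α S}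
  | unit (c : Colour) (x y : ℕ) :
      Ax {spider c 0 {x, y}} {line x y}
  /- Copying. -/
  | copy (c : Colour) (w a b : ℕ) :
      Ax {spider c 0 {w}, spider c.swap 0 {w, a, b}} {spider c 0 {a}, spider c 0 {b}}
  /- Bialgebra. -/
  | bialgebra (c : Colour) (a b a' b' p q r s w : ℕ) :
      Ax {spider c 0 {a, p, q}, spider c 0 {b, r, s},
          spider c.swap 0 {a', p, r}, spider c.swap 0 {b', q, s}}
        {spider c.swap 0 {a, b, w}, spider c 0 {w, a', b'}}
  /- `π`-commutation. -/
  | pi_delta (c : Colour) (a b b' p q w : ℕ) :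
      Ax {spider c 0 {a, p, q}, spider c.swap (ang Real.pi) {p, b},
          spider c.swap (ang Real.pi) {q, b'}}
        {spider c.swap (ang Real.pi) {a, w}, spider c 0 {w, b, b'}}
  | pi_eps (c : Colour) (a w : ℕ) :
      Ax {spider c.swap (ang Real.pi) {a, w}, spider c 0 {w}} {spider c 0 {a}}
  /- The equations for `H`. -/
  | had_had (a b w : ℕ) :
      Ax {had a w, had w b} {line a b}
  | had_delta (c : Colour) (a b b' p q w : ℕ) :
      Ax {had a w, spider c 0 {w, b, b'}} {spider c.swap 0 {a, p, q}, had p b, had q b'}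
  | had_eps (c : Colour) (a w : ℕ) :
      Ax {had a w, spider c 0 {w}} {spider c.swap 0 {a}}
  | had_phase (c : Colour) (α : Real.Angle) (a b w w' : ℕ) :
      Ax {had a w, spider c α {w, b}} {spider c.swap α {a, w'}, had w' b}
  /- Scalar factors are suppressed: a vertex without legs of phase `α ≠ π`, and a vertex of phase
  `α` joined to one of the other colour of phase `0` or `π`. In Hilbert spaces these are the non-zero
  numbers `1 + exp (i α)`, `√2` and `√2 exp (i α)`. The vertex without legs of phase `π` is the
  number `0` and is kept. -/
  | scalar (c : Colour) (α : Real.Angle) (hα : α ≠ ang Real.pi) :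
      Ax {spider c α 0} 0
  | scalar_zero (c : Colour) (α : Real.Angle) (w : ℕ) :
      Ax {spider c α {w}, spider c.swap 0 {w}} 0
  | scalar_pi (c : Colour) (α : Real.Angle) (w : ℕ) :
      Ax {spider c α {w}, spider c.swap (ang Real.pi) {w}} 0

/-- `Derivable E D D'`: the equation `D = D'` is derivable in the red-green calculus extended by
the equations in `E` as additional axioms. The last two rules say that equations may be used
inside any larger diagram and that the names of wires carry no meaning. -/
inductive Derivable (E : Set Equation) : Net ℕ → Net ℕ → Prop
  | hyp (e : Equation) (he : e ∈ E) : Derivable E e.lhs e.rhs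
  | ax {D D' : Net ℕ} (h : Ax D D') (hD : D.IsDiagram) (hD' : D'.IsDiagram) : Derivable E D D'
  | refl (D : Net ℕ) : Derivable E D D
  | symm {D D' : Net ℕ} (h : Derivable E D D') : Derivable E D' D
  | trans {D D' D'' : Net ℕ} (h : Derivable E D D') (h' : Derivable E D' D'') : Derivable E D D''
  | context {D D' : Net ℕ} (C : Net ℕ) (h : Derivable E D D')
      (hD : (D + C).IsDiagram) (hD' : (D' + C).IsDiagram) : Derivable E (D + C) (D' + C)
  | rename {D D' : Net ℕ} (f : ℕ ↪ ℕ) (h : Derivable E D D') :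
      Derivable E (D.rename f) (D'.rename f)

/-! ### Graph states and local complementation -/

/-- Wires in the pictures of graph states: the output wire `out v` of the qubit `v`, the wire
`mid v` between the dot of `v` and a gate applied to this qubit, and the wire `half v w` from
the dot of `v` to the `H` on the edge between `v` and `w`. -/
inductive Wire (V : Type)
  | out (v : V)
  | mid (v : V)
  | half (v w : V)

/-- The `H` on an edge of the graph. -/
def edgeHad {V : Type} : Sym2 V → Vertex (Wire V) :=
  Sym2.lift ⟨fun v w => had (.half v w) (.half w v), fun v w => by
    simp only [had, Vertex.mk.injEq, true_and]
    exact Multiset.pair_comm _ _⟩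

open Classical in
/-- The graph state of `G`: one green dot for each vertex, two dots connected through an `H` if and
only if they are adjacent, and one output wire `o v` at each dot. -/
noncomputable def graphState {V : Type} [Fintype V] (G : SimpleGraph V) (o : V → Wire V) :
    Net (Wire V) :=
  Finset.univ.val.map (fun v : V =>
      spider .green 0 (o v ::ₘ (Finset.univ.filter fun w => G.Adj v w).val.map (Wire.half v)))
    + G.edgeFinset.val.map edgeHad

/-- Local complementation `G * u`: the edges between neighbours of `u` are complemented. -/
def localComplement {V : Type} (G : SimpleGraph V) (u : V) : SimpleGraph V where
  Adj v w := v ≠ w ∧ Xor (G.Adj v w) (G.Adj u v ∧ G.Adj u w)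
  symm := ⟨fun v w h => ⟨h.1.symm, by
    have := h.2
    rwa [G.adj_comm w v, and_comm (a := G.Adj u w)]⟩⟩
  loopless := ⟨fun _ h => h.1 rfl⟩

open Classical in
/-- The state `R_x(θ)^(u) R_z(-θ)^(N(u)) |G⟩`. -/
noncomputable def rotatedGraphState {V : Type} [Fintype V] (G : SimpleGraph V) (u : V) (θ : ℝ) :
    Net (Wire V) :=
  graphState G (fun v => if v = u ∨ G.Adj u v then .mid v else .out v)
    + {spider .red (ang θ) {.out u, .mid u}}
    + (Finset.univ.filter fun v => G.Adj u v).val.map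
        (fun v => spider .green (ang (-θ)) {.out v, .mid v})

/-- The local complementation property, with a red rotation by `θ` at `u` and green rotations by
`-θ` at its neighbours, is derivable from `E` for all finite simple graphs `G` and vertices `u`. -/
def VanDenNest (E : Set Equation) (θ : ℝ) : Prop :=
  ∀ (V : Type) [Fintype V] (G : SimpleGraph V) (u : V) (ν : Wire V ↪ ℕ),
    Derivable E ((rotatedGraphState G u θ).rename ν)
      ((graphState (localComplement G u) Wire.out).rename ν)

/-- The Euler decomposition `H = R_Z(-π/2) ∘ R_X(-π/2) ∘ R_Z(-π/2)` is derivable from `E`. -/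
def EulerDecomposition (E : Set Equation) : Prop :=
  ∀ a b x y : ℕ, [a, b, x, y].Nodup →
    Derivable E {had a b}
      {spider .green (ang (-(Real.pi / 2))) {a, x}, spider .red (ang (-(Real.pi / 2))) {x, y},
        spider .green (ang (-(Real.pi / 2))) {y, b}}

end RedGreen

/-!
A wire of a diagram is read as a variable which is allowed any number of ends: the net stands for
the diagram in which the ends of each variable are joined by a green vertex of phase `0`. By the
spider law this is consistent, hidden variables behave like bound variables, and a green vertex of
phase `0` becomes an identification of variables. In this reading a graph state is just a net of
vertices `H`, one for each edge, on the variables of its vertices.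

For the path `1 - 0 - 2`, local complementation at `0` adds the edge between `1` and `2`. Plugging
vertices of degree one into its open ends turns the property into the Euler decomposition of `H`.
Conversely, the Euler decomposition lets one prove local complementation for a star by induction on
the number of its leaves. The general case follows by toggling the edges between the neighbours of
`u`, because two parallel vertices `H` cancel.
-/

namespace RedGreen

/-! ### Wires and renaming -/

section Wires

variable {W W' W'' ι : Type}

/-- All the legs of a net, as a multiset of wires. -/
def wires (D : Net W) : Multiset W := (D.map Vertex.legs).sum

@[simp] lemma wires_zero : wires (0 : Net W) = 0 := rfl

@[simp] lemma wires_add (D C : Net W) : wires (D + C) = wires D + wires C := by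
  simp [wires]

@[simp] lemma wires_singleton (v : Vertex W) : wires ({v} : Net W) = v.legs := by
  simp [wires]

@[simp] lemma wires_cons (v : Vertex W) (D : Net W) : wires (v ::ₘ D) = v.legs + wires D := by
  simp [wires]

@[simp] lemma wires_sum (s : Finset ι) (D : ι → Net W) :
    wires (∑ i ∈ s, D i) = ∑ i ∈ s, wires (D i) :=
  map_sum (⟨⟨wires, wires_zero⟩, wires_add⟩ : Net W →+ Multiset W) D s

lemma mem_wires {D : Net W} {w : W} : w ∈ wires D ↔ ∃ v ∈ D, w ∈ v.legs := by
  induction D using Multiset.induction_on with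
  | empty => simp
  | cons v D ih => simp [ih]

lemma exists_eq_add_of_mem_wires {D : Net W} {w : W} (h : w ∈ wires D) :
    ∃ k S C, D = {⟨k, w ::ₘ S⟩} + C := by
  obtain ⟨⟨k, L⟩, hv, hw⟩ := mem_wires.1 h
  obtain ⟨S, rfl⟩ := Multiset.exists_cons_of_mem hw
  obtain ⟨C, rfl⟩ := Multiset.exists_cons_of_mem hv
  exact ⟨k, S, C, rfl⟩

@[simp] lemma rename_zero (f : W → W') : Net.rename f (0 : Net W) = 0 := rfl

@[simp] lemma rename_add (f : W → W') (D C : Net W) :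
    Net.rename f (D + C) = Net.rename f D + Net.rename f C := by
  simp [Net.rename]

@[simp] lemma rename_singleton (f : W → W') (v : Vertex W) :
    Net.rename f ({v} : Net W) = {⟨v.kind, v.legs.map f⟩} := by
  simp [Net.rename]

@[simp] lemma rename_cons (f : W → W') (v : Vertex W) (D : Net W) :
    Net.rename f (v ::ₘ D) = ⟨v.kind, v.legs.map f⟩ ::ₘ Net.rename f D := by
  simp [Net.rename]

@[simp] lemma rename_sum (f : W → W') (s : Finset ι) (D : ι → Net W) :
    Net.rename f (∑ i ∈ s, D i) = ∑ i ∈ s, Net.rename f (D i) :=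
  map_sum (⟨⟨Net.rename f, rename_zero f⟩, rename_add f⟩ : Net W →+ Net W') D s

lemma wires_rename (f : W → W') (D : Net W) : wires (Net.rename f D) = (wires D).map f := by
  induction D using Multiset.induction_on with
  | empty => simp
  | cons v D ih => simp [ih]

lemma rename_rename (f : W → W') (g : W' → W'') (D : Net W) :
    Net.rename g (Net.rename f D) = Net.rename (g ∘ f) D := by
  simp [Net.rename]

lemma rename_congr {f g : W → W'} {D : Net W} (h : ∀ w ∈ wires D, f w = g w) :
    Net.rename f D = Net.rename g D := by
  refine Multiset.map_congr rfl fun v hv => ?_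
  rw [Multiset.map_congr rfl fun w hw => h w (mem_wires.2 ⟨v, hv, hw⟩)]

lemma rename_eq_self {f : W → W} {D : Net W} (h : ∀ w ∈ wires D, f w = w) :
    Net.rename f D = D := by
  rw [rename_congr (g := id) h]
  simp [Net.rename]

end Wires

section HasArity

variable {W W' ι : Type}

/-- Every `H` and every piece of wire has exactly two legs: the part of `Net.IsDiagram` that does
not restrict the number of ends of a wire. -/
def HasArity (D : Net W) : Prop :=
  ∀ v ∈ D, v.kind = .had ∨ v.kind = .line → v.legs.card = 2

@[simp] lemma hasArity_zero : HasArity (0 : Net W) := by simp [HasArity]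

@[simp] lemma hasArity_add {D C : Net W} : HasArity (D + C) ↔ HasArity D ∧ HasArity C := by
  simp only [HasArity, Multiset.mem_add, or_imp, forall_and]
  tauto

@[simp] lemma hasArity_singleton {v : Vertex W} :
    HasArity ({v} : Net W) ↔ (v.kind = .had ∨ v.kind = .line → v.legs.card = 2) := by
  simp [HasArity]

@[simp] lemma hasArity_cons {v : Vertex W} {D : Net W} :
    HasArity (v ::ₘ D) ↔ (v.kind = .had ∨ v.kind = .line → v.legs.card = 2) ∧ HasArity D := by
  rw [← Multiset.singleton_add, hasArity_add, hasArity_singleton]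

@[simp] lemma hasArity_rename {f : W → W'} {D : Net W} :
    HasArity (Net.rename f D) ↔ HasArity D := by
  simp [HasArity, Net.rename]

@[simp] lemma hasArity_sum {s : Finset ι} {D : ι → Net W} :
    HasArity (∑ i ∈ s, D i) ↔ ∀ i ∈ s, HasArity (D i) := by
  classical
  induction s using Finset.induction_on with
  | empty => simp
  | insert i s hi ih => simp [Finset.sum_insert hi, ih]

end HasArity

section Generators

variable {W W' : Type}

/-- The net with a single green vertex. -/
def Z (α : Real.Angle) (S : Multiset W) : Net W := {spider .green α S}

/-- The net with a single red vertex. -/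
def X (α : Real.Angle) (S : Multiset W) : Net W := {spider .red α S}

/-- The net with a single vertex `H`. -/
def H (x y : W) : Net W := {had x y}

/-- The net with a single piece of wire. -/
def L (x y : W) : Net W := {line x y}

@[simp] lemma wires_Z (α : Real.Angle) (S : Multiset W) : wires (Z α S) = S := wires_singleton _

@[simp] lemma wires_X (α : Real.Angle) (S : Multiset W) : wires (X α S) = S := wires_singleton _

@[simp] lemma wires_H (x y : W) : wires (H x y) = {x, y} := wires_singleton _

@[simp] lemma wires_L (x y : W) : wires (L x y) = {x, y} := wires_singleton _

@[simp] lemma hasArity_Z (α : Real.Angle) (S : Multiset W) : HasArity (Z α S) := by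
  simp [Z, spider]

@[simp] lemma hasArity_X (α : Real.Angle) (S : Multiset W) : HasArity (X α S) := by
  simp [X, spider]

@[simp] lemma hasArity_H (x y : W) : HasArity (H x y) := by simp [H, had]

@[simp] lemma hasArity_L (x y : W) : HasArity (L x y) := by simp [L, line]

@[simp] lemma rename_Z (f : W → W') (α : Real.Angle) (S : Multiset W) :
    (Z α S).rename f = Z α (S.map f) := rename_singleton _ _

@[simp] lemma rename_X (f : W → W') (α : Real.Angle) (S : Multiset W) :
    (X α S).rename f = X α (S.map f) := rename_singleton _ _

@[simp] lemma rename_H (f : W → W') (x y : W) : (H x y).rename f = H (f x) (f y) := by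
  simp [H, had]

@[simp] lemma rename_L (f : W → W') (x y : W) : (L x y).rename f = L (f x) (f y) := by
  simp [L, line]

lemma H_comm (x y : W) : H x y = H y x := by
  simp only [H, had, Multiset.pair_comm]

lemma L_comm (x y : W) : L x y = L y x := by
  simp only [L, line, Multiset.pair_comm]

end Generators

lemma deg_eq_count (D : Net ℕ) (x : ℕ) : D.deg x = (wires D).count x := by
  induction D using Multiset.induction_on with
  | empty => simp [Net.deg]
  | cons v D ih => simp_all [Net.deg]

lemma isDiagram_iff {D : Net ℕ} :
    D.IsDiagram ↔ (∀ x, (wires D).count x ≤ 2) ∧ HasArity D := by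
  simp only [Net.IsDiagram, HasArity, deg_eq_count]

lemma isDiagram_of_wires_le {D D' : Net ℕ} (h : D.IsDiagram) (hw : wires D' ≤ wires D)
    (ha : HasArity D') : D'.IsDiagram :=
  isDiagram_iff.2 ⟨fun x => (Multiset.count_le_of_le x hw).trans ((isDiagram_iff.1 h).1 x), ha⟩

lemma isDiagram_of_add {D C : Net ℕ} (h : (D + C).IsDiagram) : D.IsDiagram :=
  isDiagram_of_wires_le h (by simp) (hasArity_add.1 (isDiagram_iff.1 h).2).1

lemma isDiagram_of_nodup {D : Net ℕ} {S : Multiset ℕ} (hS : S.Nodup) (hD : wires D ≤ S + S)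
    (ha : HasArity D) : D.IsDiagram := by
  refine isDiagram_iff.2 ⟨fun x => (Multiset.count_le_of_le x hD).trans ?_, ha⟩
  have := Multiset.nodup_iff_count_le_one.1 hS x
  rw [Multiset.count_add]
  lia

/-! ### Renaming inner wires -/

section Substitution

/-- The map that sends `a` to `b` and leaves everything else in place. -/
def sub (a b : ℕ) : ℕ → ℕ := Function.update id a b

@[simp] lemma sub_self (a b : ℕ) : sub a b a = b := by simp [sub]

lemma sub_of_ne {a b x : ℕ} (h : x ≠ a) : sub a b x = x := by simp [sub, h]

lemma map_sub_of_notMem {a b : ℕ} {S : Multiset ℕ} (h : a ∉ S) : S.map (sub a b) = S :=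
  (Multiset.map_congr rfl fun _ hx => sub_of_ne (ne_of_mem_of_not_mem hx h)).trans S.map_id'

lemma rename_sub_of_notMem {a b : ℕ} {D : Net ℕ} (h : a ∉ wires D) : D.rename (sub a b) = D :=
  rename_eq_self fun _ hx => sub_of_ne (ne_of_mem_of_not_mem hx h)

lemma count_map_sub {a b : ℕ} (hab : a ≠ b) (S : Multiset ℕ) (z : ℕ) :
    (S.map (sub a b)).count z =
      if z = b then S.count a + S.count b else if z = a then 0 else S.count z := by
  induction S using Multiset.induction_on with
  | empty => simp
  | cons w S ih =>
    rw [Multiset.map_cons, Multiset.count_cons, ih]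
    simp only [Multiset.count_cons]
    by_cases hw : w = a
    · subst hw
      grind [sub_self]
    · grind [sub_of_ne]

lemma isDiagram_rename_sub {D : Net ℕ} {a b : ℕ} (hd : D.IsDiagram) (hab : a ≠ b)
    (h : (wires D).count a + (wires D).count b ≤ 2) : (D.rename (sub a b)).IsDiagram := by
  obtain ⟨hc, ha⟩ := isDiagram_iff.1 hd
  refine isDiagram_iff.2 ⟨fun z => ?_, hasArity_rename.2 ha⟩
  rw [wires_rename, count_map_sub hab]
  split_ifs
  exacts [h, Nat.zero_le _, hc z]

end Substitution

section Derivations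

variable {E : Set Equation}

lemma derivable_of_eq {D D' : Net ℕ} (h : D = D') : Derivable E D D' := h ▸ .refl D

lemma derivable_ax {A A' : Net ℕ} (C : Net ℕ) (h : Ax A A') (hD : (A + C).IsDiagram)
    (hD' : (A' + C).IsDiagram) : Derivable E (A + C) (A' + C) :=
  .context C (.ax h (isDiagram_of_add hD) (isDiagram_of_add hD')) hD hD'

lemma derivable_fuse {w : ℕ} {S T : Multiset ℕ} {C : Net ℕ}
    (h : (Z 0 (w ::ₘ S) + Z 0 (w ::ₘ T) + C).IsDiagram) :
    Derivable E (Z 0 (w ::ₘ S) + Z 0 (w ::ₘ T) + C) (Z 0 (S + T) + C) := by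
  have key := derivable_ax (E := E) C (.fuse .green 0 0 w S T) h
    (isDiagram_of_wires_le h ?_ (by simpa [spider] using (isDiagram_iff.1 h).2))
  · rwa [add_zero] at key
  · simp only [wires_add, wires_Z, wires_singleton, spider]
    gcongr <;> exact Multiset.le_cons_self _ _

lemma derivable_rename {D D' : Net ℕ} {g : ℕ → ℕ} (h : Derivable E D D')
    (hg : Set.InjOn g {x | x ∈ wires D ∨ x ∈ wires D'}) :
    Derivable E (D.rename g) (D'.rename g) := by
  let A : Finset ℕ := (wires D + wires D').toFinset
  have hA (x) : x ∈ A ↔ x ∈ wires D ∨ x ∈ wires D' := by simp [A]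
  have hB (x) (hx : x ∈ A) : g x ≤ A.sup g := Finset.le_sup hx
  let f : ℕ → ℕ := fun x => if x ∈ A then g x else x + A.sup g + 1
  have hf : Function.Injective f := by
    intro x y hxy
    have hinj : x ∈ A → y ∈ A → g x = g y → x = y := fun hx hy =>
      hg ((hA x).1 hx) ((hA y).1 hy)
    grind
  have hfg (x) (hx : x ∈ A) : f x = g x := if_pos hx
  rw [← rename_congr fun w hw => hfg w ((hA w).2 (.inl hw)),
    ← rename_congr fun w hw => hfg w ((hA w).2 (.inr hw))]
  exact h.rename ⟨f, hf⟩

lemma derivable_absorb {K : Net ℕ} {a b : ℕ} (hd : (K + L a b).IsDiagram)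
    (ha : (wires K).count a = 1) : Derivable E (K + L a b) (K.rename (sub a b)) := by
  obtain ⟨k, S, C, rfl⟩ := exists_eq_add_of_mem_wires (Multiset.count_pos.1 (ha ▸ one_pos))
  simp only [wires_add, wires_singleton, Multiset.cons_add, Multiset.count_cons_self,
    Multiset.count_add] at ha
  have hS : a ∉ S := Multiset.count_eq_zero.1 (by lia)
  have hC : a ∉ wires C := Multiset.count_eq_zero.1 (by lia)
  have hr : Net.rename (sub a b) ({⟨k, a ::ₘ S⟩} + C) = {⟨k, b ::ₘ S⟩} + C := by
    simp [map_sub_of_notMem hS, rename_sub_of_notMem hC]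
  rw [add_right_comm] at hd ⊢
  rw [hr]
  refine derivable_ax C (.absorb k a b S) hd (isDiagram_of_wires_le hd ?_ ?_)
  · simp only [wires_add, wires_singleton, wires_L, Multiset.insert_eq_cons,
      ← Multiset.singleton_add]
    rw [show {a} + S + ({a} + {b}) + wires C = ({b} + S + wires C) + ({a} + {a}) by abel]
    exact Multiset.le_add_right _ _
  · have := (isDiagram_iff.1 hd).2
    simp_all

lemma derivable_rename_sub {D : Net ℕ} {x y : ℕ} (hd : D.IsDiagram) (hx : (wires D).count x = 2)
    (hy : y ∉ wires D) : Derivable E D (D.rename (sub x y)) := by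
  obtain ⟨k, S, C, rfl⟩ := exists_eq_add_of_mem_wires
    (Multiset.count_pos.1 (hx ▸ two_pos : 0 < (wires D).count x))
  obtain ⟨hc, ha⟩ := isDiagram_iff.1 hd
  simp only [wires_add, wires_singleton, Multiset.cons_add, Multiset.count_cons_self,
    Multiset.count_add, Multiset.mem_cons, Multiset.mem_add, not_or] at hx hy hc
  have hyx : y ≠ x := hy.1
  have hyS := Multiset.count_eq_zero.2 hy.2.1
  have hyC := Multiset.count_eq_zero.2 hy.2.2
  have hd' : Net.IsDiagram ({⟨k, y ::ₘ S⟩} + L y x + C) := by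
    refine isDiagram_iff.2 ⟨fun z => ?_, by simp_all⟩
    have := hc z
    simp only [wires_add, wires_singleton, wires_L, Multiset.insert_eq_cons, Multiset.count_add,
      Multiset.count_cons, Multiset.count_singleton] at this ⊢
    grind
  have hsplit : Derivable E ({⟨k, x ::ₘ S⟩} + C) ({⟨k, y ::ₘ S⟩} + L y x + C) :=
    (derivable_ax C (.absorb k y x S) hd' hd).symm
  refine hsplit.trans ?_
  rw [add_right_comm, L_comm] at hd' ⊢
  refine (derivable_absorb hd' (by simp [hyx.symm]; lia)).trans (derivable_of_eq ?_)
  simp [sub_of_ne hyx]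

open Classical in
lemma derivable_rename_fresh {D : Net ℕ} (hd : D.IsDiagram) (g : ℕ → ℕ) (A : Finset ℕ)
    (hA : ∀ a ∈ A, (wires D).count a = 2) (hg : Set.InjOn g A) (hgD : ∀ a ∈ A, g a ∉ wires D) :
    Derivable E D (D.rename fun x => if x ∈ A then g x else x) := by
  induction A using Finset.induction_on generalizing D with
  | empty => exact derivable_of_eq (rename_eq_self (by simp)).symm
  | insert a A ha ih =>
    simp only [Finset.mem_insert, forall_eq_or_imp] at hA hgD
    have hmem (b) (hb : b ∈ A) : b ∈ wires D := Multiset.count_pos.1 (hA.2 b hb ▸ two_pos)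
    have haD : a ∈ wires D := Multiset.count_pos.1 (hA.1 ▸ two_pos)
    have hne : a ≠ g a := ne_of_mem_of_not_mem haD hgD.1
    have hgA (b) (hb : b ∈ A) : g b ≠ g a := fun h =>
      ha (hg (by simp [hb]) (by simp) h ▸ hb)
    have hgaA : g a ∉ A := fun h => hgD.1 (hmem _ h)
    have hga := Multiset.count_eq_zero.2 hgD.1
    refine (derivable_rename_sub hd hA.1 hgD.1).trans ((ih (isDiagram_rename_sub hd hne (by lia))
      (fun b hb => ?_) (hg.mono (by simp)) fun b hb => ?_).trans (derivable_of_eq ?_))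
    · rw [wires_rename, count_map_sub hne, if_neg (ne_of_mem_of_not_mem hb hgaA),
        if_neg (ne_of_mem_of_not_mem hb ha), hA.2 b hb]
    · rw [wires_rename, ← Multiset.count_eq_zero, count_map_sub hne, if_neg (hgA b hb)]
      split_ifs
      exacts [rfl, Multiset.count_eq_zero.2 (hgD.2 b hb)]
    · rw [rename_rename]
      refine rename_congr fun x _ => ?_
      by_cases hx : x = a
      · simp [hx, hgaA]
      · simp [sub_of_ne hx, hx]

end Derivations

/-! ### Expansions -/

section Expansion

/-- The legs of the green vertex that stands for the variable `x`, when `f` assigns a variable to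
every wire in `S` and the variables in `O` are open. -/
def star (O : Finset ℕ) (f : ℕ → ℕ) (S : Multiset ℕ) (x : ℕ) : Multiset ℕ :=
  (if x ∈ O then {x} else 0) + S.filter (f · = x)

/-- The vertices of `M`, with their legs joined by green vertices of phase `0`, one for each
variable in `A`: a leg `w` is joined to the vertex of the variable `f w`. The vertex of a variable
`x ∈ O` has in addition an open end, which is also called `x`. -/
noncomputable def expand (O A : Finset ℕ) (M : Net ℕ) (f : ℕ → ℕ) : Net ℕ :=
  M + ∑ x ∈ A, Z 0 (star O f (wires M) x)

/-- `expand O A M f` is a reading as a diagram of the net `D`, whose wires are considered as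
variables and may have any number of ends: `M` is obtained from `D` by putting each leg on a wire
of its own, and `f` sends the wire of a leg back to its variable. -/
structure IsExpansion (O A : Finset ℕ) (D M : Net ℕ) (f : ℕ → ℕ) : Prop where
  open_subset : O ⊆ A
  wires_subset : ∀ x ∈ wires D, x ∈ A
  nodup : (wires M).Nodup
  notMem : ∀ w ∈ wires M, w ∉ A
  rename_eq : M.rename f = D

variable {O A : Finset ℕ} {D M : Net ℕ} {f : ℕ → ℕ}

lemma IsExpansion.maps (h : IsExpansion O A D M f) : ∀ w ∈ wires M, f w ∈ A := fun w hw =>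
  h.wires_subset _ <| by
    rw [← h.rename_eq, wires_rename]
    exact Multiset.mem_map_of_mem f hw

lemma IsExpansion.notMem_open (h : IsExpansion O A D M f) : ∀ w ∈ wires M, w ∉ O :=
  fun w hw hO => h.notMem w hw (h.open_subset hO)

lemma IsExpansion.mono {A' : Finset ℕ} (h : IsExpansion O A D M f) (hA : A ⊆ A')
    (hA' : ∀ w ∈ wires M, w ∉ A') : IsExpansion O A' D M f :=
  ⟨h.open_subset.trans hA, fun x hx => hA (h.wires_subset x hx), h.nodup, hA', h.rename_eq⟩

lemma sum_star (hO : O ⊆ A) {S : Multiset ℕ} (hf : ∀ w ∈ S, f w ∈ A) :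
    ∑ x ∈ A, star O f S x = O.val + S := by
  simp only [star, Finset.sum_add_distrib]
  rw [Finset.sum_ite_mem, Finset.inter_eq_right.2 hO, Finset.sum_multiset_singleton]
  congr 1
  ext w
  simp only [Multiset.count_sum', Multiset.count_filter]
  rw [Finset.sum_ite_eq]
  split_ifs with hw
  · rfl
  · exact (Multiset.count_eq_zero.2 fun hm => hw (hf w hm)).symm

lemma IsExpansion.wires_expand (h : IsExpansion O A D M f) :
    wires (expand O A M f) = wires M + (O.val + wires M) := by
  simp [expand, sum_star h.open_subset h.maps]

lemma IsExpansion.mem_wires_expand (h : IsExpansion O A D M f) {w : ℕ} :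
    w ∈ wires (expand O A M f) ↔ w ∈ wires M ∨ w ∈ O := by
  simp only [h.wires_expand, Multiset.mem_add, Finset.mem_val]
  tauto

lemma IsExpansion.hasArity_expand (h : IsExpansion O A D M f) (ha : HasArity D) :
    HasArity (expand O A M f) := by
  rw [← h.rename_eq, hasArity_rename] at ha
  simp [expand, ha]

lemma IsExpansion.nodup_add_open (h : IsExpansion O A D M f) : (wires M + O.val).Nodup :=
  Multiset.nodup_add.2 ⟨h.nodup, O.nodup, Multiset.disjoint_left.2 fun hw => h.notMem_open _ hw⟩

lemma IsExpansion.isDiagram_expand (h : IsExpansion O A D M f) (ha : HasArity D) :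
    (expand O A M f).IsDiagram := by
  refine isDiagram_of_nodup h.nodup_add_open ?_ (h.hasArity_expand ha)
  rw [h.wires_expand, show wires M + O.val + (wires M + O.val) =
    wires M + (O.val + wires M) + O.val by abel]
  exact Multiset.le_add_right _ _

lemma map_star {τ g f' : ℕ → ℕ} {S : Multiset ℕ} {x : ℕ} (hO : ∀ y ∈ O, τ y = g y)
    (hgO : g x ∈ O.image g ↔ x ∈ O) (hf : ∀ w ∈ S, f' (τ w) = g x ↔ f w = x) :
    (star O f S x).map τ = star (O.image g) f' (S.map τ) (g x) := by
  have hS : (S.map τ).filter (f' · = g x) = (S.filter (f · = x)).map τ := by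
    rw [Multiset.filter_map]
    exact congrArg _ (Multiset.filter_congr fun w hw => hf w hw)
  rw [star, star, Multiset.map_add, hS]
  simp only [hgO]
  split_ifs with hx
  · simp [hO x hx]
  · rfl

lemma IsExpansion.rename_expand (h : IsExpansion O A D M f) {τ g f' : ℕ → ℕ}
    (hO : ∀ x ∈ O, τ x = g x) (hf : ∀ w ∈ wires M, f' (τ w) = g (f w)) (hg : Set.InjOn g A) :
    (expand O A M f).rename τ = expand (O.image g) (A.image g) (M.rename τ) f' := by
  rw [expand, expand, Finset.sum_image hg, rename_add, rename_sum]
  refine congrArg _ (Finset.sum_congr rfl fun x hx => ?_)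
  rw [rename_Z, wires_rename, map_star hO]
  · simp only [Finset.mem_image]
    exact ⟨fun ⟨y, hy, hyx⟩ => hg (h.open_subset hy) hx hyx ▸ hy, fun hx => ⟨x, hx, rfl⟩⟩
  · exact fun w hw => by rw [hf w hw, hg.eq_iff (h.maps w hw) hx]

end Expansion

section ExistsExpansion

lemma rename_add_piecewise {M N : Net ℕ} {f e : ℕ → ℕ} (h : Disjoint (wires M) (wires N)) :
    (M + N).rename (fun w => if w ∈ wires M then f w else e w) = M.rename f + N.rename e := by
  rw [rename_add, rename_congr fun w hw => if_pos hw,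
    rename_congr fun w hw => if_neg (Multiset.disjoint_right.1 h hw)]

lemma exists_nodup_map_eq (B : Finset ℕ) (S : Multiset ℕ) :
    ∃ (T : Multiset ℕ) (f : ℕ → ℕ), T.Nodup ∧ (∀ w ∈ T, w ∉ B) ∧ T.map f = S := by
  induction S using Multiset.induction_on with
  | empty => exact ⟨0, id, by simp⟩
  | cons a S ih =>
    obtain ⟨T, f, hT, hB, rfl⟩ := ih
    obtain ⟨w, hw⟩ := Infinite.exists_notMem_finset (B ∪ T.toFinset)
    simp only [Finset.mem_union, Multiset.mem_toFinset, not_or] at hw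
    refine ⟨w ::ₘ T, Function.update f w a, by simp [hT, hw], by simpa [hw] using hB, ?_⟩
    rw [Multiset.map_cons, Function.update_self]
    exact congrArg _ (Multiset.map_congr rfl fun x hx =>
      Function.update_of_ne (ne_of_mem_of_not_mem hx hw.2) _ _)

lemma exists_nodup_rename_eq (B : Finset ℕ) (D : Net ℕ) :
    ∃ (M : Net ℕ) (f : ℕ → ℕ), (wires M).Nodup ∧ (∀ w ∈ wires M, w ∉ B) ∧ M.rename f = D := by
  induction D using Multiset.induction_on with
  | empty => exact ⟨0, id, by simp⟩
  | cons v D ih =>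
    obtain ⟨M, f, hM, hMB, rfl⟩ := ih
    obtain ⟨T, e, hT, hTB, he⟩ := exists_nodup_map_eq (B ∪ (wires M).toFinset) v.legs
    simp only [Finset.mem_union, Multiset.mem_toFinset, not_or] at hTB
    let N : Net ℕ := {⟨v.kind, T⟩}
    have hN : wires N = T := wires_singleton _
    have hdis : Disjoint (wires N) (wires M) := by
      rw [hN]
      exact Multiset.disjoint_left.2 fun hw => (hTB _ hw).2
    refine ⟨N + M, fun w => if w ∈ wires N then e w else f w, ?_, ?_, ?_⟩
    · rw [wires_add]
      exact Multiset.nodup_add.2 ⟨hN ▸ hT, hM, hdis⟩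
    · intro w hw
      rw [wires_add, Multiset.mem_add, hN] at hw
      exact hw.elim (fun h => (hTB w h).1) (hMB w)
    · rw [rename_add_piecewise hdis, rename_singleton, he]
      rfl

lemma exists_isExpansion {O A : Finset ℕ} (B : Finset ℕ) {D : Net ℕ} (hO : O ⊆ A)
    (hD : ∀ x ∈ wires D, x ∈ A) : ∃ M f, IsExpansion O A D M f ∧ ∀ w ∈ wires M, w ∉ B := by
  obtain ⟨M, f, hM, hB, h⟩ := exists_nodup_rename_eq (A ∪ B) D
  simp only [Finset.mem_union, not_or] at hB
  exact ⟨M, f, ⟨hO, hD, hM, fun w hw => (hB w hw).1, h⟩, fun w hw => (hB w hw).2⟩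

end ExistsExpansion

section Uniqueness

variable {E : Set Equation} {O A : Finset ℕ} {D M M' : Net ℕ} {f f' : ℕ → ℕ}

lemma exists_map_eq_of_rel {r : ℕ → ℕ → Prop} {S S' : Multiset ℕ} (h : Multiset.Rel r S S')
    (hS : S.Nodup) : ∃ τ : ℕ → ℕ, S.map τ = S' ∧ ∀ w ∈ S, r w (τ w) := by
  induction h with
  | zero => exact ⟨id, by simp⟩
  | @cons a b S S' hab _ ih =>
    rw [Multiset.nodup_cons] at hS
    obtain ⟨τ, rfl, hr⟩ := ih hS.2
    have hτ (w) (hw : w ∈ S) : Function.update τ a b w = τ w :=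
      Function.update_of_ne (ne_of_mem_of_not_mem hw hS.1) _ _
    refine ⟨Function.update τ a b, ?_, ?_⟩
    · rw [Multiset.map_cons, Function.update_self, Multiset.map_congr rfl hτ]
    · simp only [Multiset.mem_cons, forall_eq_or_imp, Function.update_self]
      exact ⟨hab, fun w hw => hτ w hw ▸ hr w hw⟩

lemma exists_rename_eq_of_rel (h : Multiset.Rel (fun v v' : Vertex ℕ =>
      v.kind = v'.kind ∧ v.legs.map f = v'.legs.map f') M M') (hM : (wires M).Nodup) :
    ∃ σ : ℕ → ℕ, M.rename σ = M' ∧ ∀ w ∈ wires M, f' (σ w) = f w := by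
  induction h with
  | zero => exact ⟨id, by simp⟩
  | @cons v v' M M' hv _ ih =>
    rw [wires_cons, Multiset.nodup_add] at hM
    obtain ⟨σ, rfl, hσ⟩ := ih hM.2.1
    obtain ⟨τ, hτ, hr⟩ := exists_map_eq_of_rel (r := fun a b => f a = f' b)
      (Multiset.rel_map.1 (Multiset.rel_eq.2 hv.2)) hM.1
    have hdis : Disjoint (wires {v}) (wires M) := by simpa using hM.2.2
    refine ⟨fun w => if w ∈ wires {v} then τ w else σ w, ?_, fun w hw => ?_⟩
    · rw [← Multiset.singleton_add, rename_add_piecewise hdis, rename_singleton, hτ, hv.1,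
        Multiset.singleton_add]
    · by_cases hwv : w ∈ v.legs
      · simp [hwv, hr w hwv]
      · simp [hwv, hσ w (by simpa [hwv] using hw)]

lemma exists_rename_eq_of_rename_eq (h : M.rename f = M'.rename f') (hM : (wires M).Nodup) :
    ∃ σ : ℕ → ℕ, M.rename σ = M' ∧ ∀ w ∈ wires M, f' (σ w) = f w :=
  exists_rename_eq_of_rel (by simpa [Net.rename, Multiset.rel_map] using Multiset.rel_eq.2 h) hM

open Classical in
lemma derivable_expand_of_disjoint (ha : HasArity D) (h : IsExpansion O A D M f)
    (h' : IsExpansion O A D M' f') (hdis : ∀ w ∈ wires M', w ∉ wires M) :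
    Derivable E (expand O A M f) (expand O A M' f') := by
  obtain ⟨σ, rfl, hσ⟩ := exists_rename_eq_of_rename_eq (h.rename_eq.trans h'.rename_eq.symm)
    h.nodup
  have hmem (w) (hw : w ∈ wires M) : σ w ∈ wires (M.rename σ) := by
    rw [wires_rename]
    exact Multiset.mem_map_of_mem σ hw
  have hinj : Set.InjOn σ (wires M).toFinset := by
    have := h'.nodup
    rw [wires_rename] at this
    simpa [Set.InjOn] using Multiset.inj_on_of_nodup_map this
  let τ : ℕ → ℕ := fun w => if w ∈ (wires M).toFinset then σ w else w
  have hτ (w) (hw : w ∈ wires M) : τ w = σ w := if_pos (Multiset.mem_toFinset.2 hw)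
  have hτO (x) (hx : x ∈ O) : τ x = x := if_neg fun hw =>
    h.notMem_open x (Multiset.mem_toFinset.1 hw) hx
  refine (derivable_rename_fresh (h.isDiagram_expand ha) σ (wires M).toFinset (fun w hw => ?_)
    hinj fun w hw => ?_).trans (derivable_of_eq ?_)
  · rw [Multiset.mem_toFinset] at hw
    simp [h.wires_expand, Multiset.count_eq_one_of_mem h.nodup hw, h.notMem_open w hw]
  · rw [Multiset.mem_toFinset] at hw
    rw [h.mem_wires_expand, not_or]
    exact ⟨hdis _ (hmem w hw), h'.notMem_open _ (hmem w hw)⟩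
  · rw [h.rename_expand (g := id) hτO (fun w hw => by rw [hτ w hw]; exact hσ w hw)
      Function.injective_id.injOn, Finset.image_id, Finset.image_id, rename_congr hτ]

lemma derivable_sum_Z_zero {K : Net ℕ} (A : Finset ℕ) (hK : K.IsDiagram) :
    Derivable E (K + ∑ _x ∈ A, Z 0 0) K := by
  induction A using Finset.induction_on with
  | empty => exact derivable_of_eq (by simp)
  | insert a A ha ih =>
    have hd : (K + ∑ _x ∈ A, Z 0 0 : Net ℕ).IsDiagram :=
      isDiagram_of_wires_le hK (by simp [-Finset.sum_const])
        (by simp [-Finset.sum_const, (isDiagram_iff.1 hK).2])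
    have hscalar : Derivable E (Z 0 0 + (K + ∑ _x ∈ A, Z 0 0)) (0 + (K + ∑ _x ∈ A, Z 0 0)) :=
      derivable_ax _ (.scalar .green 0 Real.Angle.pi_ne_zero.symm)
        (isDiagram_of_wires_le hd (by simp) (by simpa using (isDiagram_iff.1 hd).2))
        (by rwa [zero_add])
    rw [Finset.sum_insert ha, add_left_comm]
    rw [zero_add] at hscalar
    exact hscalar.trans ih

lemma derivable_expand_mono {A' : Finset ℕ} (hA : A ⊆ A') (ha : HasArity D)
    (h : IsExpansion O A D M f) : Derivable E (expand O A' M f) (expand O A M f) := by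
  have hstar : ∑ x ∈ A' \ A, Z 0 (star O f (wires M) x) = ∑ _x ∈ A' \ A, Z 0 0 := by
    refine Finset.sum_congr rfl fun x hx => ?_
    have hxA := (Finset.mem_sdiff.1 hx).2
    rw [star, if_neg fun hxO => hxA (h.open_subset hxO), zero_add, Multiset.filter_eq_nil.2]
    rintro w hw rfl
    exact hxA (h.maps w hw)
  rw [expand, ← Finset.sum_sdiff hA, hstar, add_comm (∑ _x ∈ _, _), ← add_assoc]
  exact derivable_sum_Z_zero _ (h.isDiagram_expand ha)

theorem derivable_expand {A' : Finset ℕ} (ha : HasArity D) (h : IsExpansion O A D M f)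
    (h' : IsExpansion O A' D M' f') : Derivable E (expand O A M f) (expand O A' M' f') := by
  have hsub {A : Finset ℕ} {M f} (h : IsExpansion O A D M f) : O ∪ (wires D).toFinset ⊆ A :=
    Finset.union_subset h.open_subset fun x hx => h.wires_subset x (Multiset.mem_toFinset.1 hx)
  obtain ⟨N, e, hN, hB⟩ := exists_isExpansion (A ∪ A' ∪ (wires M + wires M').toFinset)
    (Finset.subset_union_left (s₁ := O) (s₂ := (wires D).toFinset)) (D := D) (by simp_all)
  simp only [Finset.mem_union, Multiset.mem_toFinset, Multiset.mem_add, not_or] at hB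
  have hl : Derivable E (expand O A M f) (expand O _ N e) :=
    (derivable_expand_of_disjoint ha h (hN.mono (hsub h) fun w hw => (hB w hw).1.1)
      fun w hw => (hB w hw).2.1).trans (derivable_expand_mono (hsub h) ha hN)
  have hr : Derivable E (expand O A' M' f') (expand O _ N e) :=
    (derivable_expand_of_disjoint ha h' (hN.mono (hsub h') fun w hw => (hB w hw).1.2)
      fun w hw => (hB w hw).2.2).trans (derivable_expand_mono (hsub h') ha hN)
  exact hl.trans hr.symm

end Uniqueness

/-! ### Equality of nets with hidden variables -/

section NetEq

variable {E : Set Equation} {O : Finset ℕ} {D D' D'' : Net ℕ}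

variable (E) in
/-- `NetEq E O D D'`: the nets `D` and `D'`, whose wires may have any number of ends, become
derivably equal diagrams when all ends of a wire are joined by a green vertex, with one more leg as
an open end if the wire belongs to `O`. The wires outside `O` are hidden, so their names carry no
meaning. Nets with an `H` or a piece of wire that has not two legs stand for no diagram. -/
def NetEq (O : Finset ℕ) (D D' : Net ℕ) : Prop :=
  (HasArity D ↔ HasArity D') ∧ (HasArity D → ∃ A M f M' f', IsExpansion O A D M f ∧
    IsExpansion O A D' M' f' ∧ Derivable E (expand O A M f) (expand O A M' f'))

namespace NetEq

lemma derivable_expand (h : NetEq E O D D') (ha : HasArity D) {A A' : Finset ℕ} {M M' : Net ℕ}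
    {f f' : ℕ → ℕ} (hM : IsExpansion O A D M f) (hM' : IsExpansion O A' D' M' f') :
    Derivable E (expand O A M f) (expand O A' M' f') := by
  obtain ⟨B, N, e, N', e', hN, hN', hd⟩ := h.2 ha
  exact (RedGreen.derivable_expand ha hM hN).trans
    (hd.trans (RedGreen.derivable_expand (h.1.1 ha) hN' hM'))

lemma of_derivable_expand (h : HasArity D ↔ HasArity D') {A : Finset ℕ}
    (hO : O ⊆ A) (hD : ∀ x ∈ wires D, x ∈ A) (hD' : ∀ x ∈ wires D', x ∈ A) (B : Finset ℕ)
    (hd : ∀ {M f M' f'}, HasArity D → HasArity D' → IsExpansion O A D M f →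
      IsExpansion O A D' M' f' → (∀ w ∈ wires M, w ∉ B) → (∀ w ∈ wires M', w ∉ B) →
      Derivable E (expand O A M f) (expand O A M' f')) : NetEq E O D D' := by
  obtain ⟨M, f, hM, hB⟩ := exists_isExpansion B hO hD
  obtain ⟨M', f', hM', hB'⟩ := exists_isExpansion B hO hD'
  exact ⟨h, fun ha => ⟨A, M, f, M', f', hM, hM', hd ha (h.1 ha) hM hM' hB hB'⟩⟩

lemma refl (O : Finset ℕ) (D : Net ℕ) : NetEq E O D D :=
  of_derivable_expand (A := O ∪ (wires D).toFinset) Iff.rfl Finset.subset_union_left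
    (by simp_all) (by simp_all) ∅ fun ha _ hM hM' _ _ => RedGreen.derivable_expand ha hM hM'

lemma of_eq (h : D = D') : NetEq E O D D' := h ▸ refl O D

lemma symm (h : NetEq E O D D') : NetEq E O D' D := by
  refine ⟨h.1.symm, fun ha => ?_⟩
  obtain ⟨A, M, f, M', f', hM, hM', hd⟩ := h.2 (h.1.2 ha)
  exact ⟨A, M', f', M, f, hM', hM, hd.symm⟩

lemma trans (h : NetEq E O D D') (h' : NetEq E O D' D'') : NetEq E O D D'' := by
  let A := O ∪ (wires D).toFinset ∪ (wires D').toFinset ∪ (wires D'').toFinset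
  refine of_derivable_expand (A := A) (h.1.trans h'.1) (fun x hx => by simp [A, hx])
    (by simp_all [A]) (by simp_all [A]) ∅ fun ha _ hM hM'' _ _ => ?_
  obtain ⟨N, e, hN, -⟩ := exists_isExpansion (O := O) (A := A) (D := D') ∅
    (fun x hx => by simp [A, hx]) (by simp_all [A])
  exact (h.derivable_expand ha hM hN).trans (h'.derivable_expand (h.1.1 ha) hN hM'')

end NetEq

end NetEq

/-! ### Contexts -/

section Contexts

variable {E : Set Equation} {O P A A' : Finset ℕ} {D D' C M M' N : Net ℕ} {f f' e : ℕ → ℕ}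

section Rename

variable {g : ℕ → ℕ}

lemma IsExpansion.rename (h : IsExpansion O A D M f) (hM : ∀ w ∈ wires M, w ∉ A.image g) :
    IsExpansion (O.image g) (A.image g) (D.rename g) M (g ∘ f) where
  open_subset := Finset.image_subset_image h.open_subset
  wires_subset x hx := by
    rw [wires_rename] at hx
    obtain ⟨y, hy, rfl⟩ := Multiset.mem_map.1 hx
    exact Finset.mem_image_of_mem g (h.wires_subset y hy)
  nodup := h.nodup
  notMem := hM
  rename_eq := by rw [← h.rename_eq, rename_rename]

lemma IsExpansion.expand_image (h : IsExpansion O A D M f) (hg : Set.InjOn g A) :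
    expand (O.image g) (A.image g) M (g ∘ f) =
      (expand O A M f).rename fun x => if x ∈ O then g x else x := by
  have hM (w) (hw : w ∈ wires M) : (if w ∈ O then g w else w) = w := if_neg (h.notMem_open w hw)
  have hf (w) (hw : w ∈ wires M) := congrArg (g ∘ f) (hM w hw)
  rw [h.rename_expand (fun x hx => if_pos hx) hf hg, rename_eq_self hM]

lemma NetEq.rename (h : NetEq E O D D')
    (hg : Set.InjOn g {x | x ∈ O ∨ x ∈ wires D ∨ x ∈ wires D'}) :
    NetEq E (O.image g) (D.rename g) (D'.rename g) := by
  let A := O ∪ (wires D + wires D').toFinset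
  have hgA : Set.InjOn g A := fun x hx y hy => hg (by simpa [A] using hx) (by simpa [A] using hy)
  have hO : O ⊆ A := Finset.subset_union_left
  refine ⟨by simp [h.1], fun ha => ?_⟩
  rw [hasArity_rename] at ha
  obtain ⟨M, f, hM, hB⟩ := exists_isExpansion (A.image g) hO (D := D) (by simp_all [A])
  obtain ⟨M', f', hM', hB'⟩ := exists_isExpansion (A.image g) hO (D := D') (by simp_all [A])
  refine ⟨_, M, _, M', _, hM.rename hB, hM'.rename hB', ?_⟩
  rw [hM.expand_image hgA, hM'.expand_image hgA]
  refine derivable_rename (h.derivable_expand ha hM hM') ?_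
  have hgO (x) (hx : x ∈ O) : g x ∈ A.image g := Finset.mem_image_of_mem g (hO hx)
  have hgOO (x) (hx : x ∈ O) (y) (hy : y ∈ O) : g x = g y → x = y := hgA (hO hx) (hO hy)
  intro x hx y hy
  simp only [Set.mem_ofPred_eq, hM.mem_wires_expand, hM'.mem_wires_expand] at hx hy ⊢
  grind

end Rename

section Juxtapose

lemma IsExpansion.add (h : IsExpansion O A D M f) (h' : IsExpansion P A' C N e)
    (hMN : Disjoint (wires M) (wires N)) (hMA : ∀ w ∈ wires M, w ∉ A')
    (hNA : ∀ w ∈ wires N, w ∉ A) :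
    IsExpansion (O ∪ P) (A ∪ A') (D + C) (M + N) fun w => if w ∈ wires M then f w else e w where
  open_subset := Finset.union_subset_union h.open_subset h'.open_subset
  wires_subset x hx := by
    rw [wires_add, Multiset.mem_add] at hx
    exact Finset.mem_union.2 (hx.imp (h.wires_subset x) (h'.wires_subset x))
  nodup := by
    rw [wires_add]
    exact Multiset.nodup_add.2 ⟨h.nodup, h'.nodup, hMN⟩
  notMem w hw := by
    rw [wires_add, Multiset.mem_add] at hw
    rw [Finset.mem_union, not_or]
    exact hw.elim (fun hw => ⟨h.notMem w hw, hMA w hw⟩) fun hw => ⟨hNA w hw, h'.notMem w hw⟩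
  rename_eq := by rw [rename_add_piecewise hMN, h.rename_eq, h'.rename_eq]

lemma star_add {S T : Multiset ℕ} (hST : Disjoint S T) (x : ℕ) :
    star O (fun w => if w ∈ S then f w else e w) (S + T) x =
      (if x ∈ O then {x} else 0) + (S.filter (f · = x) + T.filter (e · = x)) := by
  rw [star, Multiset.filter_add]
  congr 2
  · exact Multiset.filter_congr fun w hw => by rw [if_pos hw]
  · exact Multiset.filter_congr fun w hw => by rw [if_neg (Multiset.disjoint_right.1 hST hw)]

lemma IsExpansion.expand_add (h : IsExpansion O A D M f) (h' : IsExpansion P A' C N e)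
    (hMN : Disjoint (wires M) (wires N)) (hA : Disjoint A A') :
    expand (O ∪ P) (A ∪ A') (M + N) (fun w => if w ∈ wires M then f w else e w) =
      expand O A M f + expand P A' N e := by
  have hl (x) (hx : x ∈ A) : star (O ∪ P) (fun w => if w ∈ wires M then f w else e w)
      (wires (M + N)) x = star O f (wires M) x := by
    have hxA' := Finset.disjoint_left.1 hA hx
    have hxP : x ∉ P := fun hxP => hxA' (h'.open_subset hxP)
    have hN : (wires N).filter (e · = x) = 0 :=
      Multiset.filter_eq_nil.2 fun w hw (hwx : e w = x) => hxA' (hwx ▸ h'.maps w hw)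
    rw [wires_add, star_add hMN, hN]
    simp [star, hxP]
  have hr (x) (hx : x ∈ A') : star (O ∪ P) (fun w => if w ∈ wires M then f w else e w)
      (wires (M + N)) x = star P e (wires N) x := by
    have hxA := Finset.disjoint_right.1 hA hx
    have hxO : x ∉ O := fun hxO => hxA (h.open_subset hxO)
    have hM : (wires M).filter (f · = x) = 0 :=
      Multiset.filter_eq_nil.2 fun w hw (hwx : f w = x) => hxA (hwx ▸ h.maps w hw)
    rw [wires_add, star_add hMN, hM]
    simp [star, hxO]
  rw [expand, Finset.sum_union hA,
    Finset.sum_congr (s₁ := A) rfl fun x hx => congrArg (Z 0) (hl x hx),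
    Finset.sum_congr (s₁ := A') rfl fun x hx => congrArg (Z 0) (hr x hx), expand, expand]
  abel

lemma NetEq.juxtapose (h : NetEq E O D D') (C : Net ℕ) (P : Finset ℕ)
    (hP : ∀ x, x ∈ O ∨ x ∈ wires D ∨ x ∈ wires D' → x ∉ wires C ∧ x ∉ P) :
    NetEq E (O ∪ P) (D + C) (D' + C) := by
  let A := O ∪ (wires D + wires D').toFinset
  let A' := P ∪ (wires C).toFinset
  have hA : Disjoint A A' := Finset.disjoint_left.2 fun x hx => by
    simpa [A', and_comm] using hP x (by simpa [A] using hx)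
  refine ⟨by simp [h.1], fun ha => ?_⟩
  obtain ⟨haD, haC⟩ := hasArity_add.1 ha
  obtain ⟨M, f, hM, hMB⟩ := exists_isExpansion A' (Finset.subset_union_left (s₁ := O)) (D := D)
    (A := A) (by simp_all [A])
  obtain ⟨M', f', hM', hMB'⟩ := exists_isExpansion A' (Finset.subset_union_left (s₁ := O))
    (D := D') (A := A) (by simp_all [A])
  obtain ⟨N, e, hN, hNB⟩ := exists_isExpansion (A ∪ (wires M + wires M').toFinset)
    (Finset.subset_union_left (s₁ := P)) (D := C) (A := A') (by simp_all [A'])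
  simp only [Finset.mem_union, Multiset.mem_toFinset, Multiset.mem_add, not_or] at hNB
  have hMN : Disjoint (wires M) (wires N) := Multiset.disjoint_right.2 fun hw => (hNB _ hw).2.1
  have hMN' : Disjoint (wires M') (wires N) := Multiset.disjoint_right.2 fun hw => (hNB _ hw).2.2
  have hD := hM.add hN hMN hMB fun w hw => (hNB w hw).1
  have hD' := hM'.add hN hMN' hMB' fun w hw => (hNB w hw).1
  refine ⟨_, _, _, _, _, hD, hD', ?_⟩
  have hd := hD.isDiagram_expand ha
  have hd' := hD'.isDiagram_expand (hasArity_add.2 ⟨h.1.1 haD, haC⟩)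
  rw [hM.expand_add hN hMN hA] at hd ⊢
  rw [hM'.expand_add hN hMN' hA] at hd' ⊢
  exact .context _ (h.derivable_expand haD hM hM') hd hd'

end Juxtapose

section Hide

variable {x : ℕ}

lemma star_of_mem {S : Multiset ℕ} (hx : x ∈ O) : star O f S x = x ::ₘ S.filter (f · = x) := by
  rw [star, if_pos hx, Multiset.singleton_add]

lemma star_of_notMem {S : Multiset ℕ} (hx : x ∉ O) : star O f S x = S.filter (f · = x) := by
  rw [star, if_neg hx, zero_add]

lemma star_erase_of_ne {S : Multiset ℕ} {y : ℕ} (hxy : y ≠ x) :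
    star (O.erase x) f S y = star O f S y := by
  simp [star, hxy]

lemma expand_eq_add_erase (hxA : x ∈ A) :
    expand O A M f =
      Z 0 (star O f (wires M) x) + (M + ∑ y ∈ A.erase x, Z 0 (star O f (wires M) y)) := by
  rw [expand, ← Finset.add_sum_erase A _ hxA]
  abel

lemma IsExpansion.erase (h : IsExpansion O A D M f) (x : ℕ) : IsExpansion (O.erase x) A D M f :=
  ⟨(Finset.erase_subset x O).trans h.open_subset, h.wires_subset, h.nodup, h.notMem, h.rename_eq⟩

lemma IsExpansion.isDiagram_expand_add {S : Multiset ℕ} (h : IsExpansion O A D M f)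
    (ha : HasArity D) (hS : S.Nodup) (hM : ∀ w ∈ wires M, w ∉ S) :
    (expand O A M f + Z 0 S).IsDiagram := by
  let P : Finset ℕ := O ∪ S.toFinset
  have hP : (wires M + P.val).Nodup :=
    Multiset.nodup_add.2 ⟨h.nodup, P.nodup, Multiset.disjoint_left.2 fun {w} hw hwP => by
      simp only [P, Finset.mem_val, Finset.mem_union, Multiset.mem_toFinset] at hwP
      exact hwP.elim (h.notMem_open w hw) (hM w hw)⟩
  have hOP : O.val ≤ P.val := Finset.val_le_iff.2 Finset.subset_union_left
  have hSP : S ≤ P.val := (Multiset.le_iff_subset hS).2 fun w hw => by simp [P, hw]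
  refine isDiagram_of_nodup hP ?_ (by simpa using h.hasArity_expand ha)
  rw [wires_add, h.wires_expand, wires_Z]
  calc wires M + (O.val + wires M) + S ≤ wires M + (P.val + wires M) + P.val := by gcongr
    _ = wires M + P.val + (wires M + P.val) := by abel

lemma IsExpansion.isDiagram_expand_add_singleton (h : IsExpansion O A D M f) (ha : HasArity D)
    (hx : x ∈ A) : (expand O A M f + Z 0 {x}).IsDiagram :=
  h.isDiagram_expand_add ha (Multiset.nodup_singleton x) fun w hw hwx =>
    h.notMem w hw (Multiset.mem_singleton.1 hwx ▸ hx)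

lemma IsExpansion.derivable_hide (h : IsExpansion O A D M f) (ha : HasArity D) (hx : x ∈ O) :
    Derivable E (expand O A M f + Z 0 {x}) (expand (O.erase x) A M f) := by
  have hxA := h.open_subset hx
  have hd := h.isDiagram_expand_add_singleton ha hxA
  rw [expand_eq_add_erase hxA, star_of_mem hx, add_right_comm] at hd ⊢
  refine (derivable_fuse (T := 0) hd).trans (derivable_of_eq ?_)
  rw [expand_eq_add_erase hxA, star_of_notMem (Finset.notMem_erase x O), add_zero,
    Finset.sum_congr rfl fun y hy => by rw [← star_erase_of_ne (Finset.ne_of_mem_erase hy)]]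

lemma NetEq.hide_erase (h : NetEq E O D D') (x : ℕ) : NetEq E (O.erase x) D D' := by
  by_cases hx : x ∈ O
  swap
  · rwa [Finset.erase_eq_of_notMem hx]
  refine ⟨h.1, fun ha => ?_⟩
  obtain ⟨A, M, f, M', f', hM, hM', hd⟩ := h.2 ha
  have ha' := h.1.1 ha
  have hx' : Derivable E (expand O A M f + Z 0 {x}) (expand O A M' f' + Z 0 {x}) := .context _ hd
    (hM.isDiagram_expand_add_singleton ha (hM.open_subset hx))
    (hM'.isDiagram_expand_add_singleton ha' (hM.open_subset hx))
  exact ⟨A, M, f, M', f', hM.erase x, hM'.erase x,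
    (hM.derivable_hide ha hx).symm.trans (hx'.trans (hM'.derivable_hide ha' hx))⟩

lemma NetEq.hide {O' : Finset ℕ} (h : NetEq E O D D') (hO : O' ⊆ O) : NetEq E O' D D' := by
  have hsdiff (P : Finset ℕ) : NetEq E (O \ P) D D' := by
    induction P using Finset.induction_on with
    | empty => rwa [Finset.sdiff_empty]
    | insert x P _ ih =>
      rw [Finset.sdiff_insert]
      exact ih.hide_erase x
  rw [← Finset.sdiff_sdiff_eq_self hO]
  exact hsdiff _

end Hide

end Contexts

section Unify

variable {E : Set Equation} {O A : Finset ℕ} {D D' M : Net ℕ} {f g : ℕ → ℕ} {x y z : ℕ}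

/-- The map that sends `x` and `y` to `z` and leaves everything else in place. -/
def merge (x y z w : ℕ) : ℕ := if w = x ∨ w = y then z else w

lemma sub_comp_merge {w : ℕ} (hw : w ≠ z) : (sub z y ∘ merge x y z) w = sub x y w := by
  grind [sub_self, sub_of_ne, merge]

lemma image_merge_erase (hz : z ∉ A) :
    (A.image (merge x y z)).erase z = (A.erase x).erase y := by
  ext w
  simp only [Finset.mem_erase, Finset.mem_image, merge]
  grind

lemma star_image_merge {S : Multiset ℕ} {b : ℕ} (hx : b ≠ x) (hy : b ≠ y) (hz : b ≠ z) :
    star (O.image (merge x y z)) (merge x y z ∘ f) S b = star O f S b := by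
  have hb (w : ℕ) : merge x y z w = b ↔ w = b := by grind [merge]
  simp [star, hb]

lemma filter_merge {S : Multiset ℕ} (hxy : x ≠ y) (hS : ∀ w ∈ S, f w ≠ z) :
    S.filter ((merge x y z ∘ f) · = z) = S.filter (f · = x) + S.filter (f · = y) := by
  have hnil : S.filter (fun w => f w = x ∧ f w = y) = 0 :=
    Multiset.filter_eq_nil.2 fun w _ h => hxy (h.1.symm.trans h.2)
  rw [Multiset.filter_add_filter, hnil, add_zero]
  exact Multiset.filter_congr fun w hw => by grind [merge]

lemma IsExpansion.expand_merge (h : IsExpansion O A D M f) (hx : x ∈ O) (hxy : x ≠ y)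
    (hzA : z ∉ A) :
    expand (O.image (merge x y z)) (A.image (merge x y z)) M (merge x y z ∘ f) =
      Z 0 (z ::ₘ ((wires M).filter (f · = x) + (wires M).filter (f · = y))) +
        (M + ∑ b ∈ (A.erase x).erase y, Z 0 (star O f (wires M) b)) := by
  have hzO : z ∈ O.image (merge x y z) := Finset.mem_image.2 ⟨x, hx, by simp [merge]⟩
  rw [expand_eq_add_erase (Finset.image_subset_image h.open_subset hzO), star_of_mem hzO,
    filter_merge hxy fun w hw => ne_of_mem_of_not_mem (h.maps w hw) hzA, image_merge_erase hzA]
  congr 2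
  refine Finset.sum_congr rfl fun b hb => ?_
  simp only [Finset.mem_erase] at hb
  rw [star_image_merge hb.2.1 hb.1 (ne_of_mem_of_not_mem hb.2.2 hzA)]

lemma IsExpansion.derivable_merge (h : IsExpansion O A D M f) (hx : x ∈ O) (hy : y ∈ O)
    (hxy : x ≠ y) (hzA : z ∉ A) (hd : (expand O A M f + Z 0 {x, y, z}).IsDiagram) :
    Derivable E (expand O A M f + Z 0 {x, y, z})
      (expand (O.image (merge x y z)) (A.image (merge x y z)) M (merge x y z ∘ f)) := by
  have hyA : y ∈ A.erase x := Finset.mem_erase.2 ⟨hxy.symm, h.open_subset hy⟩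
  let S := (wires M).filter (f · = x)
  let T := (wires M).filter (f · = y)
  let C : Net ℕ := M + ∑ b ∈ (A.erase x).erase y, Z 0 (star O f (wires M) b)
  have hstart : expand O A M f + Z 0 {x, y, z} =
      Z 0 (x ::ₘ S) + Z 0 (x ::ₘ {y, z}) + (Z 0 (y ::ₘ T) + C) := by
    rw [expand, ← Finset.add_sum_erase A _ (h.open_subset hx),
      ← Finset.add_sum_erase (A.erase x) _ hyA, star_of_mem hx, star_of_mem hy]
    simp only [C, S, T, Multiset.insert_eq_cons]
    abel
  have hmid : Z 0 (S + {y, z}) + (Z 0 (y ::ₘ T) + C) =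
      Z 0 (y ::ₘ (z ::ₘ S)) + Z 0 (y ::ₘ T) + C := by
    rw [show S + {y, z} = y ::ₘ (z ::ₘ S) by
      simp only [Multiset.insert_eq_cons, ← Multiset.singleton_add]; abel, add_assoc]
  rw [h.expand_merge hx hxy hzA, ← Multiset.cons_add]
  rw [hstart] at hd ⊢
  have hd' : (Z 0 (S + {y, z}) + (Z 0 (y ::ₘ T) + C)).IsDiagram := isDiagram_of_wires_le hd
    (by simp only [wires_add, wires_Z]; gcongr <;> exact Multiset.le_cons_self _ _)
    (by simpa using (isDiagram_iff.1 hd).2)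
  refine (derivable_fuse hd).trans ?_
  rw [hmid] at hd' ⊢
  exact derivable_fuse hd'

lemma NetEq.merge (h : NetEq E O D D') (hx : x ∈ O) (hy : y ∈ O) (hxy : x ≠ y)
    (hz : ∀ w, w ∈ O ∨ w ∈ wires D ∨ w ∈ wires D' → w ≠ z) :
    NetEq E (O.image (merge x y z)) (D.rename (merge x y z)) (D'.rename (merge x y z)) := by
  let A : Finset ℕ := O ∪ (wires D + wires D').toFinset
  have hzA : z ∉ A := fun hzA => hz z (by simpa [A] using hzA) rfl
  have hO : O ⊆ A := Finset.subset_union_left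
  let B : Finset ℕ := insert z (A.image (RedGreen.merge x y z))
  obtain ⟨M, f, hM, hB⟩ := exists_isExpansion B hO (D := D) (by simp_all [A])
  obtain ⟨M', f', hM', hB'⟩ := exists_isExpansion B hO (D := D') (by simp_all [A])
  simp only [B, Finset.mem_insert, not_or] at hB hB'
  refine ⟨by simp [h.1], fun ha => ?_⟩
  rw [hasArity_rename] at ha
  have hnodup : ({x, y, z} : Multiset ℕ).Nodup := by
    simp [hxy, hz x (.inl hx), hz y (.inl hy)]
  have hS {w : ℕ} (hw : w ∈ ({x, y, z} : Multiset ℕ)) : w ∈ O ∨ w = z := by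
    simp only [Multiset.insert_eq_cons, Multiset.mem_cons, Multiset.mem_singleton] at hw
    grind
  have hd := hM.isDiagram_expand_add ha hnodup fun w hw hwS =>
    (hS hwS).elim (hM.notMem_open w hw) (hB w hw).1
  have hd' := hM'.isDiagram_expand_add (h.1.1 ha) hnodup fun w hw hwS =>
    (hS hwS).elim (hM'.notMem_open w hw) (hB' w hw).1
  exact ⟨_, M, _, M', _, hM.rename fun w hw => (hB w hw).2, hM'.rename fun w hw => (hB' w hw).2,
    (hM.derivable_merge hx hy hxy hzA hd).symm.trans
      ((Derivable.context _ (h.derivable_expand ha hM hM') hd hd').trans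
        (hM'.derivable_merge hx hy hxy hzA hd'))⟩

lemma NetEq.rename_sub (h : NetEq E O D D') (hx : x ∈ O) (hy : y ∈ O) (hxy : x ≠ y) :
    NetEq E (O.erase x) (D.rename (sub x y)) (D'.rename (sub x y)) := by
  obtain ⟨z, hz⟩ := Infinite.exists_notMem_finset (O ∪ (wires D + wires D').toFinset)
  simp only [Finset.mem_union, Multiset.mem_toFinset, Multiset.mem_add, not_or] at hz
  have hsub (w) (hw : w ∈ O ∨ w ∈ wires D ∨ w ∈ wires D') :
      (sub z y ∘ RedGreen.merge x y z) w = sub x y w := sub_comp_merge (by grind)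
  have hinj : Set.InjOn (sub z y) {w | w ∈ O.image (RedGreen.merge x y z) ∨
      w ∈ wires (D.rename (RedGreen.merge x y z)) ∨
      w ∈ wires (D'.rename (RedGreen.merge x y z))} := by
    have hy (w : ℕ) : RedGreen.merge x y z w ≠ y := by grind [RedGreen.merge]
    intro w hw w' hw'
    simp only [Set.mem_ofPred_eq, Finset.mem_image, wires_rename, Multiset.mem_map] at hw hw'
    have := sub_self z y
    have := @sub_of_ne z y
    grind
  have key := (h.merge hx hy hxy (z := z) (by grind)).rename hinj
  rw [rename_rename, rename_rename, rename_congr fun w hw => hsub w (.inr (.inl hw)),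
    rename_congr fun w hw => hsub w (.inr (.inr hw)), Finset.image_image,
    Finset.image_congr fun w hw => hsub w (.inl hw)] at key
  convert key using 1
  ext w
  have := sub_self x y
  have := @sub_of_ne x y
  simp only [Finset.mem_erase, Finset.mem_image]
  grind

lemma NetEq.unify {P : Finset ℕ} (h : NetEq E O D D') (hP : P ⊆ O)
    (hg : ∀ x ∈ P, g x ∈ O \ P) : NetEq E (O \ P) (D.rename fun x => if x ∈ P then g x else x)
      (D'.rename fun x => if x ∈ P then g x else x) := by
  suffices ∀ Q ⊆ P, NetEq E (O \ Q) (D.rename fun x => if x ∈ Q then g x else x)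
      (D'.rename fun x => if x ∈ Q then g x else x) from this P subset_rfl
  intro Q
  induction Q using Finset.induction_on with
  | empty =>
    intro _
    simpa [rename_eq_self] using h
  | insert a Q ha ih =>
    intro hQ
    rw [Finset.insert_subset_iff] at hQ
    have hga := Finset.mem_sdiff.1 (hg a hQ.1)
    have key := (ih hQ.2).rename_sub (x := a) (y := g a) (by simp [ha, hP hQ.1])
      (by simp only [Finset.mem_sdiff]; grind) (ne_of_mem_of_not_mem hQ.1 hga.2)
    have hcomp : sub a (g a) ∘ (fun x => if x ∈ Q then g x else x) =
        fun x => if x ∈ insert a Q then g x else x := by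
      funext x
      have := sub_self a (g a)
      have := @sub_of_ne a (g a)
      grind
    rwa [rename_rename, rename_rename, hcomp, ← Finset.sdiff_insert] at key

/-- The map that moves `O` out of the way by `b` and acts on the other wires as `g`. -/
def shift (O : Finset ℕ) (b : ℕ) (g : ℕ → ℕ) (x : ℕ) : ℕ := if x ∈ O then x + b else g x

/-- The map that acts on the wires in `O`, once moved away by `shift O b g`, as `g`. -/
def unshift (O : Finset ℕ) (b : ℕ) (g : ℕ → ℕ) (x : ℕ) : ℕ :=
  if x ∈ O.image (· + b) then g (x - b) else x

lemma unshift_of_lt {b : ℕ} (hx : x < b) : unshift O b g x = x := if_neg fun h => by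
  obtain ⟨y, -, hy⟩ := Finset.mem_image.1 h
  lia

lemma rename_unshift_of_lt {b : ℕ} (hD : ∀ x ∈ wires D, x < b) :
    D.rename (unshift O b g) = D := rename_eq_self fun x hx => unshift_of_lt (hD x hx)

lemma rename_unshift_rename_shift {b : ℕ} (hD : ∀ x ∈ wires D, g x < b) :
    (D.rename (shift O b g)).rename (unshift O b g) = D.rename g := by
  rw [rename_rename]
  refine rename_congr fun x hx => ?_
  rw [Function.comp_apply, shift]
  split_ifs with hxO
  · rw [unshift, if_pos (Finset.mem_image_of_mem (· + b) hxO), Nat.add_sub_cancel]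
  · exact unshift_of_lt (hD x hx)

lemma NetEq.context (h : NetEq E O D D') (g : ℕ → ℕ) (C : Net ℕ) (O' : Finset ℕ)
    (hg : ∀ x, x ∈ wires D ∨ x ∈ wires D' → x ∉ O → g x ∉ wires C ∧ g x ∉ O' ∧
      ∀ y, y ∈ wires D ∨ y ∈ wires D' ∨ y ∈ O → g y = g x → y = x) :
    NetEq E O' (D.rename g + C) (D'.rename g + C) := by
  obtain ⟨b, hb⟩ := Finset.exists_nat_subset_range
    (O' ∪ (wires C).toFinset ∪ O.image g ∪ (wires D + wires D').toFinset.image g)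
  simp only [Finset.union_subset_iff, Finset.image_subset_iff] at hb
  obtain ⟨⟨⟨hO', hC⟩, hO⟩, hD⟩ := hb
  simp only [Finset.subset_iff, Multiset.mem_toFinset, Multiset.mem_add, Finset.mem_range]
    at hO' hC hO hD
  have himage : O.image (shift O b g) = O.image (· + b) :=
    Finset.image_congr fun x hx => if_pos hx
  have hinj : Set.InjOn (shift O b g) {x | x ∈ O ∨ x ∈ wires D ∨ x ∈ wires D'} := by
    intro x hx y hy hxy
    simp only [Set.mem_ofPred_eq] at hx hy
    grind [shift]
  have hjux := (h.rename hinj).juxtapose C (O.image g ∪ O') (by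
    simp only [Finset.mem_image, wires_rename, Multiset.mem_map, Finset.mem_union]
    grind [shift])
  rw [himage] at hjux
  have hunify := hjux.unify (P := O.image (· + b)) (g := fun x => g (x - b))
    Finset.subset_union_left (by
      simp only [Finset.mem_image, Finset.mem_union, Finset.mem_sdiff]
      grind)
  change NetEq E _ ((_ + C).rename (unshift O b g)) ((_ + C).rename (unshift O b g)) at hunify
  rw [rename_add, rename_add, rename_unshift_of_lt hC,
    rename_unshift_rename_shift fun x hx => hD x (.inl hx),
    rename_unshift_rename_shift fun x hx => hD x (.inr hx)] at hunify
  refine hunify.hide fun x hx => ?_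
  simp only [Finset.mem_sdiff, Finset.mem_union, Finset.mem_image] at hx ⊢
  grind

end Unify

/-! ### Diagrams -/

section Contract

variable {E : Set Equation} {K : Net ℕ} {F : Multiset ℕ} {x v w : ℕ}

lemma derivable_unit (hd : (K + Z 0 {v, w}).IsDiagram) (hv : (wires K).count v = 1) :
    Derivable E (K + Z 0 {v, w}) (K.rename (sub v w)) := by
  have hd' : (K + L v w).IsDiagram :=
    isDiagram_of_wires_le hd (by simp) (by simpa using (isDiagram_iff.1 hd).2)
  have hunit : Derivable E (Z 0 {v, w} + K) (L v w + K) :=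
    derivable_ax K (.unit .green v w) (add_comm K _ ▸ hd) (add_comm K _ ▸ hd')
  rw [add_comm, add_comm _ K] at hunit
  exact hunit.trans (derivable_absorb hd' hv)

/-- The map that sends the wires in `F` to `x` and leaves everything else in place. -/
def contract (F : Multiset ℕ) (x w : ℕ) : ℕ := if w ∈ F then x else w

lemma derivable_contract_one (hd : (K + Z 0 {x, w}).IsDiagram) (hw : (wires K).count w = 1)
    (hx : x ∉ wires K) :
    Derivable E (K + Z 0 {x, w}) (K.rename (contract {w} x)) ∧
      (K.rename (contract {w} x)).IsDiagram := by
  have hcontract : contract {w} x = sub w x := by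
    funext z
    simp [contract, sub, Function.update_apply]
  have hxw : x ≠ w := fun h => hx (h ▸ Multiset.count_pos.1 (by lia))
  rw [hcontract, Multiset.pair_comm]
  exact ⟨derivable_unit (by rwa [Multiset.pair_comm]) hw,
    isDiagram_rename_sub (isDiagram_of_add hd) hxw.symm
      (by rw [hw, Multiset.count_eq_zero.2 hx]; lia)⟩

lemma derivable_contract_two (hd : (K + Z 0 {v, w}).IsDiagram) (hv : (wires K).count v = 1)
    (hw : (wires K).count w = 1) (hvw : v ≠ w) (hx : x ∉ wires K) :
    Derivable E (K + Z 0 {v, w}) (K.rename (contract {v, w} x)) ∧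
      (K.rename (contract {v, w} x)).IsDiagram := by
  have hcontract : contract {v, w} x = sub w x ∘ sub v w := by
    funext z
    simp only [contract, Multiset.insert_eq_cons, Multiset.mem_cons, Multiset.mem_singleton, sub,
      Function.comp_apply, Function.update_apply, id_eq]
    grind
  have hxv : x ≠ v := fun h => hx (h ▸ Multiset.count_pos.1 (by lia))
  have hxw : x ≠ w := fun h => hx (h ▸ Multiset.count_pos.1 (by lia))
  have hd' : (K.rename (sub v w)).IsDiagram :=
    isDiagram_rename_sub (isDiagram_of_add hd) hvw (by lia)
  have hw' : (wires (K.rename (sub v w))).count w = 2 := by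
    rw [wires_rename, count_map_sub hvw, if_pos rfl, hv, hw]
  have hx' : x ∉ wires (K.rename (sub v w)) := by
    rw [← Multiset.count_eq_zero, wires_rename, count_map_sub hvw, if_neg hxw, if_neg hxv,
      Multiset.count_eq_zero.2 hx]
  rw [hcontract, ← rename_rename]
  exact ⟨(derivable_unit hd hv).trans (derivable_rename_sub hd' hw' hx'),
    isDiagram_rename_sub hd' hxw.symm (by rw [hw', Multiset.count_eq_zero.2 hx'])⟩

lemma derivable_contract (hd : (K + Z 0 (if F.card = 1 then x ::ₘ F else F)).IsDiagram)
    (hF : F.Nodup) (hcard : F.card ≤ 2) (hFK : ∀ w ∈ F, w ∈ wires K) (hx : x ∉ wires K) :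
    Derivable E (K + Z 0 (if F.card = 1 then x ::ₘ F else F)) (K.rename (contract F x)) ∧
      (K.rename (contract F x)).IsDiagram := by
  have hcount {w : ℕ} (hw : w ∈ F) : (wires K).count w = 1 := by
    have hpos := Multiset.count_pos.2 (hFK w hw)
    have hle := (isDiagram_iff.1 hd).1 w
    have hFw : 0 < (if F.card = 1 then x ::ₘ F else F).count w :=
      Multiset.count_pos.2 (by split_ifs <;> simp [hw])
    simp only [wires_add, wires_Z, Multiset.count_add] at hle
    lia
  obtain h0 | h1 | h2 : F.card = 0 ∨ F.card = 1 ∨ F.card = 2 := by lia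
  · obtain rfl := Multiset.card_eq_zero.1 h0
    have hdK : K.IsDiagram := isDiagram_of_add hd
    rw [rename_eq_self fun w _ => by simp [contract]]
    exact ⟨by simpa using derivable_sum_Z_zero {x} hdK, hdK⟩
  · obtain ⟨w, rfl⟩ := Multiset.card_eq_one.1 h1
    rw [if_pos h1] at hd ⊢
    exact derivable_contract_one hd (hcount (by simp)) hx
  · obtain ⟨v, w, rfl⟩ := Multiset.card_eq_two.1 h2
    rw [if_neg (by lia)] at hd ⊢
    exact derivable_contract_two hd (hcount (by simp)) (hcount (by simp)) (by simpa using hF) hx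

end Contract

section Diagrams

variable {E : Set Equation} {O A : Finset ℕ} {D D' M : Net ℕ} {f : ℕ → ℕ}

lemma IsExpansion.card_filter (h : IsExpansion O A D M f) (x : ℕ) :
    ((wires M).filter (f · = x)).card = (wires D).count x := by
  rw [← h.rename_eq, wires_rename, Multiset.count_map]
  simp only [eq_comm]

lemma IsExpansion.star_eq (h : IsExpansion O A D M f) {x : ℕ}
    (hO : x ∈ O ↔ (wires D).count x = 1) :
    star O f (wires M) x = if ((wires M).filter (f · = x)).card = 1 then
      x ::ₘ (wires M).filter (f · = x) else (wires M).filter (f · = x) := by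
  rw [h.card_filter]
  split_ifs with hx
  exacts [star_of_mem (hO.2 hx), star_of_notMem (mt hO.1 hx)]

lemma mem_star {S : Multiset ℕ} {x w : ℕ} :
    w ∈ star O f S x ↔ w = x ∧ x ∈ O ∨ w ∈ S ∧ f w = x := by
  simp only [star, Multiset.mem_add, Multiset.mem_filter]
  split_ifs <;> simp_all

/-- The net between a net and its expansion in which the variables in `B` are still joined by
green vertices. -/
noncomputable def partialExpand (O B : Finset ℕ) (M : Net ℕ) (f : ℕ → ℕ) : Net ℕ :=
  M.rename (fun w => if f w ∈ B then w else f w) + ∑ x ∈ B, Z 0 (star O f (wires M) x)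

lemma IsExpansion.partialExpand_self (h : IsExpansion O A D M f) :
    partialExpand O A M f = expand O A M f := by
  rw [partialExpand, expand, rename_eq_self fun w hw => if_pos (h.maps w hw)]

lemma IsExpansion.derivable_partialExpand_insert (h : IsExpansion O A D M f) {x : ℕ}
    {B : Finset ℕ} (hO : x ∈ O ↔ (wires D).count x = 1) (hcard : (wires D).count x ≤ 2)
    (hx : x ∉ B) (hB : insert x B ⊆ A)
    (hd : (partialExpand O (insert x B) M f).IsDiagram) :
    Derivable E (partialExpand O (insert x B) M f) (partialExpand O B M f) ∧
      (partialExpand O B M f).IsDiagram := by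
  let F := (wires M).filter (f · = x)
  let K : Net ℕ := M.rename (fun w => if f w ∈ insert x B then w else f w) +
    ∑ y ∈ B, Z 0 (star O f (wires M) y)
  have hxA : x ∈ A := hB (Finset.mem_insert_self x B)
  have hBA {y : ℕ} (hy : y ∈ B) : y ∈ A := hB (Finset.mem_insert_of_mem hy)
  have hF {w : ℕ} : w ∈ F ↔ w ∈ wires M ∧ f w = x := Multiset.mem_filter
  have hK : partialExpand O (insert x B) M f =
      K + Z 0 (if F.card = 1 then x ::ₘ F else F) := by
    rw [partialExpand, Finset.sum_insert hx, h.star_eq hO, add_comm (Z _ _), ← add_assoc]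
  have hKx : K.rename (contract F x) = partialExpand O B M f := by
    rw [partialExpand, rename_add, rename_rename, rename_sum]
    refine congrArg₂ _ (rename_congr fun w hw => ?_) (Finset.sum_congr rfl fun y hy => ?_)
    · have hfw : f w ∉ wires M := fun hfw => h.notMem _ hfw (h.maps w hw)
      simp only [Function.comp_apply, contract, hF]
      grind
    · have hfix (w) (hw : w ∈ star O f (wires M) y) : contract F x w = w := if_neg fun hwF => by
        rw [mem_star] at hw
        have := h.notMem w (hF.1 hwF).1
        grind
      rw [rename_Z, Multiset.map_congr rfl hfix, Multiset.map_id']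
  rw [hK] at hd ⊢
  rw [← hKx]
  refine derivable_contract hd (h.nodup.filter _) (by rwa [h.card_filter]) (fun w hw => ?_) ?_
  · obtain ⟨hwM, hfw⟩ := hF.1 hw
    rw [wires_add, wires_rename]
    exact Multiset.mem_add.2 (.inl (Multiset.mem_map.2 ⟨w, hwM, by simp [hfw]⟩))
  · simp only [K, wires_add, wires_rename, wires_sum, wires_Z, Multiset.mem_add, Multiset.mem_map,
      Multiset.mem_sum, mem_star]
    have := h.notMem
    grind

theorem IsExpansion.derivable_expand_self (h : IsExpansion O A D M f) (hD : D.IsDiagram)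
    (hO : ∀ x, x ∈ O ↔ (wires D).count x = 1) : Derivable E (expand O A M f) D := by
  suffices ∀ B ⊆ A, (partialExpand O B M f).IsDiagram → Derivable E (partialExpand O B M f) D by
    rw [← h.partialExpand_self]
    refine this A subset_rfl ?_
    rw [h.partialExpand_self]
    exact h.isDiagram_expand (isDiagram_iff.1 hD).2
  intro B
  induction B using Finset.induction_on with
  | empty => exact fun _ _ => derivable_of_eq (by simp [partialExpand, h.rename_eq])
  | insert x B hx ih =>
    intro hB hd
    obtain ⟨hstep, hd'⟩ := h.derivable_partialExpand_insert (E := E) (hO x)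
      ((isDiagram_iff.1 hD).1 x) hx hB hd
    exact hstep.trans (ih ((Finset.subset_insert x B).trans hB) hd')

/-- `D` is a diagram whose open ends are the wires in `O`. -/
def HasOpenEnds (D : Net ℕ) (O : Finset ℕ) : Prop :=
  D.IsDiagram ∧ ∀ x, x ∈ O ↔ (wires D).count x = 1

theorem netEq_iff_derivable (hD : HasOpenEnds D O) (hD' : HasOpenEnds D' O) :
    NetEq E O D D' ↔ Derivable E D D' := by
  have ha := (isDiagram_iff.1 hD.1).2
  have ha' := (isDiagram_iff.1 hD'.1).2
  have hself {D M A f} (hD : HasOpenEnds D O) (hM : IsExpansion O A D M f) :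
      Derivable E (expand O A M f) D := hM.derivable_expand_self hD.1 hD.2
  constructor
  · intro h
    obtain ⟨A, M, f, M', f', hM, hM', hd⟩ := h.2 ha
    exact (hself hD hM).symm.trans (hd.trans (hself hD' hM'))
  · exact fun hd => .of_derivable_expand (A := O ∪ (wires D + wires D').toFinset)
      (iff_of_true ha ha') Finset.subset_union_left (by simp_all) (by simp_all) ∅
      fun _ _ hM hM' _ _ => (hself hD hM).trans (hd.trans (hself hD' hM').symm)

lemma hasOpenEnds_of_wires {M : Multiset ℕ} (ha : HasArity D) (hM : (M + O.val).Nodup)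
    (hw : wires D = O.val + (M + M)) : HasOpenEnds D O := by
  refine ⟨isDiagram_of_nodup hM (hw ▸ ?_) ha, fun x => ?_⟩
  · rw [show M + O.val + (M + O.val) = O.val + (M + M) + O.val by abel]
    exact Multiset.le_add_right _ _
  · have hx := Multiset.nodup_iff_count_le_one.1 hM x
    rw [← Finset.mem_val, ← Multiset.count_pos, hw]
    simp only [Multiset.count_add] at hx ⊢
    lia

lemma IsExpansion.hasOpenEnds_expand (h : IsExpansion O A D M f) (ha : HasArity D) :
    HasOpenEnds (expand O A M f) O :=
  hasOpenEnds_of_wires (h.hasArity_expand ha) h.nodup_add_open (by rw [h.wires_expand]; abel)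

lemma IsExpansion.netEq_expand (h : IsExpansion O A D M f) :
    NetEq E O D (expand O A M f) := by
  have ha : HasArity D ↔ HasArity (expand O A M f) := by simp [← h.rename_eq, expand]
  refine .of_derivable_expand (A := O ∪ (wires D + wires (expand O A M f)).toFinset) ha
    Finset.subset_union_left (by simp_all) (by simp_all) ∅ fun ha _ hM hM' _ _ => ?_
  have hopen := h.hasOpenEnds_expand ha
  exact (derivable_expand ha hM h).trans (hM'.derivable_expand_self hopen.1 hopen.2).symm

end Diagrams

/-! ### The axioms for nets with hidden variables -/

section Reasoning

variable {E : Set Equation} {O O' : Finset ℕ} {A B C D D' : Net ℕ} {g : ℕ → ℕ}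

instance : Trans (NetEq E O) (NetEq E O) (NetEq E O) := ⟨NetEq.trans⟩

namespace NetEq

lemma of_not_hasArity (hD : ¬HasArity D) (hD' : ¬HasArity D') : NetEq E O D D' :=
  ⟨iff_of_false hD hD', fun ha => absurd ha hD⟩

lemma rename_open (h : NetEq E O D D') (g : ℕ → ℕ)
    (hD : ∀ x, x ∈ wires D ∨ x ∈ wires D' → x ∈ O) :
    NetEq E O' (D.rename g) (D'.rename g) := by
  simpa using h.context g 0 O' fun x hx hxO => absurd (hD x hx) hxO

lemma rename_hidden (h : NetEq E O D D') (g : ℕ → ℕ) (k : ℕ)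
    (hD : ∀ x, x ∈ wires D ∨ x ∈ wires D' → x ∈ O ∨ x = k) (hk : g k ∉ O')
    (hg : ∀ x ∈ O, g x ≠ g k) : NetEq E O' (D.rename g) (D'.rename g) := by
  simpa using h.context g 0 O' fun x hx hxO => by
    obtain rfl := (hD x hx).resolve_left hxO
    exact ⟨by simp, hk, fun y hy hyx => by grind⟩

lemma within (C : Net ℕ) (h : NetEq E (O ∪ (wires C).toFinset) D D')
    (hA : A = D + C := by (try simp only [Multiset.insert_eq_cons]) <;> abel)
    (hB : D' + C = B := by (try simp only [Multiset.insert_eq_cons]) <;> abel) : NetEq E O A B := by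
  subst hA hB
  simpa [rename_eq_self] using h.context id C O fun x _ hxO => by
    simp only [Finset.mem_union, Multiset.mem_toFinset, not_or] at hxO
    exact ⟨hxO.2, hxO.1, fun _ _ h => h⟩

lemma reorder (h : NetEq E O D D') (hA : A = D := by abel) (hB : D' = B := by abel) :
    NetEq E O A B := by
  subst hA hB
  exact h

end NetEq

lemma hasOpenEnds_of_count (ha : HasArity D)
    (h : ∀ x ∈ O ∪ (wires D).toFinset,
      (wires D).count x ≤ 2 ∧ (x ∈ O ↔ (wires D).count x = 1)) : HasOpenEnds D O := by
  simp only [Finset.mem_union, Multiset.mem_toFinset] at h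
  have hcount (x) : (wires D).count x ≤ 2 ∧ (x ∈ O ↔ (wires D).count x = 1) := by
    by_cases hx : x ∈ O ∨ x ∈ wires D
    · exact h x hx
    · rw [not_or] at hx
      simp [hx]
  exact ⟨isDiagram_iff.2 ⟨fun x => (hcount x).1, ha⟩, fun x => (hcount x).2⟩

lemma NetEq.of_ax (h : Ax D D')
    (hD : HasOpenEnds D O := by
      refine hasOpenEnds_of_count (by simp) ?_
      simp only [wires_add, wires_zero, wires_Z, wires_X, wires_H, wires_L]; decide)
    (hD' : HasOpenEnds D' O := by
      refine hasOpenEnds_of_count (by simp) ?_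
      simp only [wires_add, wires_zero, wires_Z, wires_X, wires_H, wires_L]; decide) :
    NetEq E O D D' :=
  (netEq_iff_derivable hD hD').2 (.ax h hD.1 hD'.1)

/-- The valuation of the variables `0, 1, 2, …` by the entries of a list, which turns an equation
between concrete nets into a rule. -/
def val (l : List ℕ) (n : ℕ) : ℕ := l.getD n 0

@[simp] lemma val_zero (a : ℕ) (l : List ℕ) : val (a :: l) 0 = a := rfl
@[simp] lemma val_one (a b : ℕ) (l : List ℕ) : val (a :: b :: l) 1 = b := rfl
@[simp] lemma val_two (a b c : ℕ) (l : List ℕ) : val (a :: b :: c :: l) 2 = c := rfl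
@[simp] lemma val_three (a b c d : ℕ) (l : List ℕ) : val (a :: b :: c :: d :: l) 3 = d := rfl

end Reasoning

section Substitution

variable {E : Set Equation} {O : Finset ℕ} {C : Net ℕ}

lemma netEq_Z_zero (x : ℕ) : NetEq E O (Z 0 {x}) 0 := by
  have h : IsExpansion {0} {0} 0 0 id := ⟨by simp, by simp, by simp, by simp, by simp⟩
  have key : NetEq E {0} 0 (Z 0 {0}) := by simpa [expand, star] using h.netEq_expand (E := E)
  simpa using (key.symm.rename_open (val [x]) (by simp) : NetEq E O _ _)

lemma mem_image_merge {P : Finset ℕ} {s x z w : ℕ} (hs : s ∈ P) (hz : z ∉ P) :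
    w ∈ P.image (merge s x z) ↔ w = z ∨ w ∈ P ∧ w ≠ s ∧ w ≠ x := by
  have : ∀ y ∈ P, y ≠ z := fun y hy => ne_of_mem_of_not_mem hy hz
  simp only [Finset.mem_image, merge]
  grind

lemma IsExpansion.hasOpenEnds_expand_add {P A : Finset ℕ} {M : Net ℕ} {f : ℕ → ℕ} {s x z : ℕ}
    (h : IsExpansion P A C M f) (ha : HasArity C) (hs : s ∈ P) (hx : x ∈ P) (hsx : s ≠ x)
    (hzP : z ∉ P) (hzM : z ∉ wires M) :
    HasOpenEnds (expand P A M f + Z 0 {s, x, z}) (P.image (merge s x z)) := by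
  have hzs : s ≠ z := ne_of_mem_of_not_mem hs hzP
  have hzx : x ≠ z := ne_of_mem_of_not_mem hx hzP
  have hmem {w : ℕ} : w ∈ ({s, x, z} : Multiset ℕ) ↔ w = s ∨ w = x ∨ w = z := by simp
  have hS : ({s, x, z} : Multiset ℕ).Nodup := by simp [hsx, hzs, hzx]
  refine ⟨h.isDiagram_expand_add ha hS fun w hw => ?_, fun w => ?_⟩
  · have := h.notMem_open w hw
    grind
  · have := h.notMem_open w
    rw [mem_image_merge hs hzP, wires_add, h.wires_expand, wires_Z]
    simp only [Multiset.count_add, Multiset.count_eq_of_nodup h.nodup,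
      Multiset.count_eq_of_nodup P.nodup, Multiset.count_eq_of_nodup hS, hmem, Finset.mem_val]
    grind

lemma netEq_merge {s x z : ℕ} (hs : s ∉ O) (hx : x ∉ O) (hsx : s ≠ x) (hzs : z ≠ s) (hzx : z ≠ x)
    (hz : z ∉ wires C) : NetEq E O (Z 0 {s, x, z} + C) (C.rename (merge s x z)) := by
  by_cases ha : HasArity C
  swap
  · exact .of_not_hasArity (by simpa) (by simpa)
  let P : Finset ℕ := insert s (insert x (O.erase z))
  let A : Finset ℕ := P ∪ (wires C).toFinset
  have hzP : z ∉ P := by simp [P, hzs, hzx]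
  have hzA : z ∉ A := by simp [A, hzP, hz]
  have hsP : s ∈ P := Finset.mem_insert_self s _
  have hxP : x ∈ P := Finset.mem_insert_of_mem (Finset.mem_insert_self x _)
  have hO : O ⊆ P.image (merge s x z) := fun w hw => (mem_image_merge hsP hzP).2 (by grind)
  obtain ⟨M, f, hM, hB⟩ := exists_isExpansion (insert z (A.image (merge s x z)))
    (Finset.subset_union_left (s₁ := P)) (D := C) (A := A) (by simp_all [A])
  simp only [Finset.mem_insert, not_or] at hB
  have hzM : z ∉ wires M := fun hzM => (hB z hzM).1 rfl
  have hmerge := hM.rename fun w hw => (hB w hw).2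
  have hopen := hM.hasOpenEnds_expand_add ha hsP hxP hsx hzP hzM
  have hexpand : NetEq E O (C + Z 0 {s, x, z}) (expand P A M f + Z 0 {s, x, z}) := by
    simpa [rename_eq_self] using hM.netEq_expand.context (E := E) id (Z 0 {s, x, z}) O
      fun w hw hwP => by
        have hwz : w ≠ z := by
          rw [hM.mem_wires_expand] at hw
          exact fun hwz => by simp_all
        simp only [id, wires_Z, Multiset.insert_eq_cons, Multiset.mem_cons, Multiset.mem_singleton]
        grind
  calc NetEq E O (Z 0 {s, x, z} + C) (expand P A M f + Z 0 {s, x, z}) := hexpand.reorder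
    NetEq E O _ (expand (P.image (merge s x z)) (A.image (merge s x z)) M (merge s x z ∘ f)) :=
      ((netEq_iff_derivable hopen (hmerge.hasOpenEnds_expand (by simpa))).2
        (hM.derivable_merge hsP hxP hsx hzA hopen.1)).hide hO
    NetEq E O _ (C.rename (merge s x z)) := hmerge.netEq_expand.symm.hide hO

lemma netEq_fuse (c : Colour) (α β : Real.Angle) {w : ℕ} {S T : Multiset ℕ} (hw : w ∉ O)
    (hS : w ∉ S) (hT : w ∉ T) :
    NetEq E O ({spider c α (w ::ₘ S)} + {spider c β (w ::ₘ T)}) {spider c (α + β) (S + T)} := by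
  obtain ⟨S', f, hS', hwS, rfl⟩ := exists_nodup_map_eq {w} S
  obtain ⟨T', g, hT', hwT, rfl⟩ := exists_nodup_map_eq (insert w S'.toFinset) T
  simp only [Finset.mem_insert, Finset.mem_singleton, Multiset.mem_toFinset, not_or] at hwS hwT
  have key : NetEq E (S' + T').toFinset
      ({spider c α (w ::ₘ S')} + {spider c β (w ::ₘ T')}) {spider c (α + β) (S' + T')} := by
    refine .of_ax (.fuse c α β w S' T') (hasOpenEnds_of_count (by simp [spider]) fun x _ => ?_)
      (hasOpenEnds_of_count (by simp [spider]) fun x _ => ?_) <;>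
    · simp only [wires_add, wires_singleton, spider, Multiset.count_add, Multiset.count_cons,
        Multiset.count_eq_of_nodup hS', Multiset.count_eq_of_nodup hT', Multiset.mem_toFinset,
        Multiset.mem_add]
      grind
  let e (x : ℕ) : ℕ := if x ∈ S' then f x else if x ∈ T' then g x else x
  have hew : e w = w := by grind
  have heS : S'.map e = S'.map f := Multiset.map_congr rfl (by grind)
  have heT : T'.map e = T'.map g := Multiset.map_congr rfl (by grind)
  have := key.rename_hidden (O' := O) e w (by simp [spider]; grind) (by rwa [hew]) (by
    simp only [Multiset.mem_map] at hS hT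
    grind)
  simpa [Net.rename, spider, hew, heS, heT] using this

lemma netEq_Z_fuse (α β : Real.Angle) {w : ℕ} {S T : Multiset ℕ} (hw : w ∉ O) (hS : w ∉ S)
    (hT : w ∉ T) : NetEq E O (Z α (w ::ₘ S) + Z β (w ::ₘ T)) (Z (α + β) (S + T)) :=
  netEq_fuse .green α β hw hS hT

lemma netEq_X_fuse (α β : Real.Angle) {w : ℕ} {S T : Multiset ℕ} (hw : w ∉ O) (hS : w ∉ S)
    (hT : w ∉ T) : NetEq E O (X α (w ::ₘ S) + X β (w ::ₘ T)) (X (α + β) (S + T)) :=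
  netEq_fuse .red α β hw hS hT

lemma netEq_unit (c : Colour) (x y : ℕ) : NetEq E O {spider c 0 {x, y}} (L x y) := by
  have key : NetEq E {0, 1} {spider c 0 {0, 1}} (L 0 1) :=
    .of_ax (.unit c 0 1) (hasOpenEnds_of_count (by simp [spider])
      (by simp only [spider, wires_singleton]; decide))
  have := key.rename_open (O' := O) (val [x, y]) (by simp [spider])
  rw [rename_L] at this
  simpa [spider, Net.rename] using this

lemma netEq_Z_two (x y : ℕ) : NetEq E O (Z 0 {x, y}) (L x y) := netEq_unit .green x y

lemma netEq_X_two (x y : ℕ) : NetEq E O (X 0 {x, y}) (L x y) := netEq_unit .red x y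

lemma triple_swap (x y z : ℕ) : ({x, y, z} : Multiset ℕ) = {y, x, z} :=
  Multiset.cons_swap x y {z}

lemma triple_rotate (x y z : ℕ) : ({x, y, z} : Multiset ℕ) = {y, z, x} := by
  rw [triple_swap, Multiset.pair_comm]

lemma netEq_Z_absorb_line (α : Real.Angle) {x y : ℕ} {S : Multiset ℕ} (hx : x ∉ O) (hS : x ∉ S)
    (hxy : x ≠ y) : NetEq E O (Z α (x ::ₘ S) + L x y) (Z α (y ::ₘ S)) :=
  calc NetEq E O (Z α (x ::ₘ S) + L x y) (Z α (x ::ₘ S) + Z 0 (x ::ₘ {y})) :=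
      .within (Z α (x ::ₘ S)) (netEq_Z_two x y).symm
    NetEq E O _ (Z (α + 0) (S + {y})) := netEq_Z_fuse α 0 hx hS (by simpa)
    NetEq E O _ (Z α (y ::ₘ S)) := .of_eq (by rw [add_zero, add_comm, Multiset.singleton_add])

lemma netEq_L_hidden {x s : ℕ} (hs : s ∉ O) (hsx : s ≠ x) : NetEq E O (L s x) 0 :=
  calc NetEq E O (L s x) (Z 0 {s} + L s x) := .within (L s x) (netEq_Z_zero s).symm
    NetEq E O _ (Z 0 {x}) := netEq_Z_absorb_line 0 hs (by simp) hsx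
    NetEq E O _ 0 := netEq_Z_zero x

lemma netEq_Z_three (x y z : ℕ) : NetEq E O (Z 0 {x, y, z}) (L x y + L x z) := by
  have key :=
    calc NetEq E {0, 1, 2} (Z 0 {0, 1, 2}) (Z 0 {1, 0, 2}) := .of_eq (by rw [triple_swap])
      NetEq E {0, 1, 2} _ (Z 0 {3, 0, 2} + L 3 1) :=
        (netEq_Z_absorb_line 0 (by decide) (by decide) (by decide)).symm
      NetEq E {0, 1, 2} _ (Z 0 {2, 3, 0} + L 3 1) := .of_eq (by rw [triple_rotate 2])
      NetEq E {0, 1, 2} _ (Z 0 {4, 3, 0} + L 4 2 + L 3 1) :=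
        .within (L 3 1) (netEq_Z_absorb_line (x := 4) (y := 2) (S := {3, 0}) 0 (by simp) (by decide)
          (by decide)).symm
      NetEq E {0, 1, 2} _ (Z 0 {3, 4, 0} + (L 3 1 + L 4 2)) :=
        .of_eq (by rw [triple_swap]; abel)
      NetEq E {0, 1, 2} _ ((L 3 1 + L 4 2).rename (merge 3 4 0)) :=
        netEq_merge (by decide) (by decide) (by decide) (by decide) (by decide) (by simp)
      NetEq E {0, 1, 2} _ (L 0 1 + L 0 2) := .of_eq (by simp [merge])
  simpa using key.rename_open (O' := O) (val [x, y, z]) (by simp)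

lemma exists_notMem_notMem_wires (O : Finset ℕ) (D : Net ℕ) : ∃ k, k ∉ O ∧ k ∉ wires D := by
  simpa using Infinite.exists_notMem_finset (O ∪ (wires D).toFinset)

lemma netEq_subst {s x : ℕ} (hs : s ∉ O) (hsx : s ≠ x) {D : Net ℕ}
    (hD : C.rename (sub s x) = D := by simp [sub, add_assoc]) : NetEq E O (L s x + C) D := by
  subst hD
  obtain ⟨k, hk, hkC⟩ := exists_notMem_notMem_wires O (C + L s x)
  obtain ⟨j, hj, hjC⟩ := exists_notMem_notMem_wires O (C + L s x + L k k)
  simp only [wires_add, wires_L, Multiset.mem_add, Multiset.insert_eq_cons, Multiset.mem_cons,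
    Multiset.mem_singleton, not_or] at hkC hjC
  let C' : Net ℕ := C.rename (sub x k)
  have hC' {w : ℕ} (hw : w ∈ wires C') : w = k ∨ w ≠ x ∧ w ∈ wires C := by
    simp only [C', wires_rename, Multiset.mem_map] at hw
    obtain ⟨v, hv, rfl⟩ := hw
    by_cases hvx : v = x
    · simp [hvx]
    · simp [sub_of_ne hvx, hvx, hv]
  have hback : (L s k + C').rename (merge k j x) = L s x + C := by
    rw [rename_add, rename_rename, rename_eq_self (D := C) fun w _ => ?_]
    · simp only [rename_L, merge]
      grind
    · simp only [Function.comp_apply, sub, Function.update_apply, merge]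
      grind
  have hsub : C'.rename (merge s k x) = C.rename (sub s x) := by
    rw [rename_rename]
    refine rename_congr fun w _ => ?_
    simp only [Function.comp_apply, sub, Function.update_apply, merge]
    grind
  calc NetEq E O (L s x + C) (Z 0 {k, j, x} + (L s k + C')) :=
      hback ▸ (netEq_merge hk hj (by grind) (by grind) (by grind) (by simp; grind)).symm
    NetEq E O _ (Z 0 {x, k, j} + (L s k + C')) := .of_eq (by rw [triple_rotate x])
    NetEq E O _ (L x k + L x j + (L s k + C')) := .within (L s k + C') (netEq_Z_three x k j)
    NetEq E O _ (L k x + L k s + C') := by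
      rw [L_comm x j, L_comm x k, L_comm s k]
      exact .within (L k x + L k s + C') (netEq_L_hidden (x := x) (s := j) (by simp; grind)
        (by grind))
    NetEq E O _ (Z 0 {k, x, s} + C') := .within C' (netEq_Z_three k x s).symm
    NetEq E O _ (Z 0 {s, k, x} + C') := .of_eq (by rw [triple_rotate s])
    NetEq E O _ (C.rename (sub s x)) :=
      hsub ▸ netEq_merge hs hk (by grind) (by grind) (by grind) (by grind)

end Substitution

section Rules

variable {E : Set Equation} {O : Finset ℕ} {α β : Real.Angle}

/-! ### Green vertices -/

lemma rename_sum_map {ι W W' : Type} (f : W → W') (s : Multiset ι) (D : ι → Net W) :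
    (s.map D).sum.rename f = (s.map fun i => (D i).rename f).sum := by
  induction s using Multiset.induction_on with
  | empty => simp
  | cons i s ih => simp [ih]

lemma netEq_Z_cons (α : Real.Angle) (x : ℕ) (S : Multiset ℕ) :
    NetEq E O (Z α (x ::ₘ S)) (Z α {x} + (S.map (L x)).sum) := by
  induction S using Multiset.induction_on generalizing x O with
  | empty => exact .of_eq (by simp)
  | cons w S ih =>
    obtain ⟨k, hk, hkS⟩ := exists_notMem_notMem_wires O (Z α (x ::ₘ w ::ₘ S))
    simp only [wires_Z, Multiset.mem_cons, not_or] at hkS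
    calc NetEq E O (Z α (x ::ₘ w ::ₘ S)) (Z (0 + α) ({x, w} + S)) := .of_eq (by simp)
      NetEq E O _ (Z 0 {k, x, w} + Z α (k ::ₘ S)) :=
        (netEq_Z_fuse 0 α hk (by simp [hkS]) hkS.2.2).symm
      NetEq E O _ (Z α (k ::ₘ S) + (L k x + L k w)) :=
        .within (Z α (k ::ₘ S)) (netEq_Z_three k x w)
      NetEq E O _ (L k x + (Z α {k} + (S.map (L k)).sum + L k w)) :=
        .within (L k x + L k w) (ih k)
      NetEq E O _ (Z α {x} + ((w ::ₘ S).map (L x)).sum) :=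
        netEq_subst hk hkS.1 (by
          have hS : S.map (fun s => L x (sub k x s)) = S.map (L x) :=
            Multiset.map_congr rfl fun s hs => by
              rw [sub_of_ne (ne_of_mem_of_not_mem hs hkS.2.2)]
          simp only [rename_add, rename_sum_map, rename_Z, rename_L, Multiset.map_singleton,
            Multiset.map_cons, Multiset.sum_cons, sub_self, sub_of_ne (Ne.symm hkS.2.1), hS]
          abel)

lemma netEq_Z_add (α β : Real.Angle) (x : ℕ) :
    NetEq E O (Z α {x} + Z β {x}) (Z (α + β) {x}) := by
  obtain ⟨k, hk, hkx⟩ := exists_notMem_notMem_wires O (Z α {x})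
  have hkx : k ≠ x := by simpa using hkx
  calc NetEq E O (Z α {x} + Z β {x}) (L k x + (Z α {k} + Z β {k})) :=
      (netEq_subst hk hkx).symm
    NetEq E O _ (Z α {k, x} + Z β {k}) :=
      .within (Z β {k}) (by simpa using (netEq_Z_cons α k {x}).symm)
    NetEq E O _ (Z (α + β) ({x} + 0)) := netEq_Z_fuse α β hk (by simpa) (by simp)

lemma netEq_Z_cancel (h : α + β = 0) (x : ℕ) : NetEq E O (Z α {x} + Z β {x}) 0 :=
  (netEq_Z_add α β x).trans (h ▸ netEq_Z_zero x)

lemma netEq_scalar (c : Colour) (hα : α ≠ ang Real.pi) : NetEq E O {spider c α 0} 0 := by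
  have key : NetEq E ∅ {spider c α 0} 0 :=
    .of_ax (.scalar c α hα) (hasOpenEnds_of_count (by simp [spider]) (by simp [spider]))
  simpa [rename_eq_self, spider] using key.rename_open (O' := O) id (by simp [spider])

/-! ### Red vertices -/

lemma netEq_Z_X_hidden (α : Real.Angle) {x : ℕ} (hx : x ∉ O) :
    NetEq E O (Z α {x} + X 0 {x}) 0 := by
  have key : NetEq E ∅ (Z α {0} + X 0 {0}) 0 := .of_ax (.scalar_zero .green α 0)
  simpa using key.rename_hidden (O' := O) (val [x]) 0 (by simp) (by simpa) (by simp)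

lemma netEq_X_hidden (α : Real.Angle) {x : ℕ} (hx : x ∉ O) : NetEq E O (X α {x}) 0 := by
  have key : NetEq E ∅ (X α {0} + Z 0 {0}) 0 := .of_ax (.scalar_zero .red α 0)
  calc NetEq E O (X α {x}) (X α {x} + Z 0 {x}) := .within (X α {x}) (netEq_Z_zero x).symm
    NetEq E O _ 0 := by
      simpa using key.rename_hidden (O' := O) (val [x]) 0 (by simp) (by simpa) (by simp)

lemma netEq_X_X_hidden (h : α + β ≠ ang Real.pi) {x : ℕ} (hx : x ∉ O) :
    NetEq E O (X α {x} + X β {x}) 0 :=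
  (netEq_X_fuse α β hx (by simp) (by simp)).trans (netEq_scalar .red h)

lemma netEq_copy (a b : ℕ) : NetEq E O (X 0 {a} + L a b) (X 0 {a} + X 0 {b}) := by
  have key :=
    calc NetEq E {0, 1} (X 0 {0} + L 0 1) (L 2 0 + (X 0 {2} + L 2 1)) :=
        (netEq_subst (by decide) (by decide)).symm
      NetEq E {0, 1} _ (X 0 {2} + Z 0 {2, 0, 1}) := .within (X 0 {2}) (netEq_Z_three 2 0 1).symm
      NetEq E {0, 1} _ (X 0 {0} + X 0 {1}) := by exact .of_ax (.copy .red 2 0 1)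
  simpa using key.rename_open (O' := O) (val [a, b]) (by simp)

lemma netEq_X_three_hidden {x y z : ℕ} (hx : x ∉ O) (hxy : x ≠ y) (hxz : x ≠ z) :
    NetEq E O (X 0 {x, y, z}) 0 := by
  have key :=
    calc NetEq E {1, 2} (X 0 {0, 1, 2}) (Z 0 {0} + X 0 {0, 1, 2}) :=
        .within (X 0 {0, 1, 2}) (netEq_Z_zero 0).symm
      NetEq E {1, 2} _ (Z 0 {1} + Z 0 {2}) := .of_ax (.copy .green 0 1 2)
      NetEq E {1, 2} _ (Z 0 {2}) := .within (Z 0 {2}) (netEq_Z_zero 1)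
      NetEq E {1, 2} _ 0 := netEq_Z_zero 2
  simpa using key.rename_hidden (O' := O) (val [x, y, z]) 0 (by simp) (by simpa)
    (by simp [hxy.symm, hxz.symm])

lemma netEq_bialgebra (a b v w : ℕ) :
    NetEq E O (X 0 {a, v, w} + X 0 {b, v, w}) (L a b + X 0 {a, v, w}) := by
  have key :=
    calc NetEq E {0, 1, 2, 3} (X 0 {0, 2, 3} + X 0 {1, 2, 3})
          (L 7 3 + (X 0 {0, 2, 3} + X 0 {1, 2, 7})) :=
        (netEq_subst (by decide) (by decide)).symm
      NetEq E {0, 1, 2, 3} _ (L 5 3 + (L 7 3 + X 0 {0, 2, 5} + X 0 {1, 2, 7})) :=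
        (netEq_subst (by decide) (by decide)).symm
      NetEq E {0, 1, 2, 3} _ (L 6 2 + (L 5 3 + L 7 3 + X 0 {0, 2, 5} + X 0 {1, 6, 7})) :=
        (netEq_subst (by decide) (by decide)).symm
      NetEq E {0, 1, 2, 3} _ (L 4 2 + (L 6 2 + L 5 3 + L 7 3 + X 0 {0, 4, 5} + X 0 {1, 6, 7})) :=
        (netEq_subst (by decide) (by decide)).symm
      NetEq E {0, 1, 2, 3} _ (Z 0 {2, 4, 6} + L 3 5 + L 3 7 + X 0 {0, 4, 5} + X 0 {1, 6, 7}) := by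
        rw [L_comm 4, L_comm 6, L_comm 5, L_comm 7]
        exact .within (L 3 5 + L 3 7 + X 0 {0, 4, 5} + X 0 {1, 6, 7}) (netEq_Z_three 2 4 6).symm
      NetEq E {0, 1, 2, 3} _ (X 0 {0, 4, 5} + X 0 {1, 6, 7} + Z 0 {2, 4, 6} + Z 0 {3, 5, 7}) :=
        .within (X 0 {0, 4, 5} + X 0 {1, 6, 7} + Z 0 {2, 4, 6}) (netEq_Z_three 3 5 7).symm
      NetEq E {0, 1, 2, 3} _ (Z 0 {0, 1, 8} + X 0 {8, 2, 3}) := by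
        exact .of_ax (.bialgebra .red 0 1 2 3 4 5 6 7 8)
      NetEq E {0, 1, 2, 3} _ (L 8 0 + (L 0 1 + X 0 {8, 2, 3})) := by
        rw [L_comm 8]
        exact .within (X 0 {8, 2, 3}) (netEq_Z_three 0 1 8)
      NetEq E {0, 1, 2, 3} _ (L 0 1 + X 0 {0, 2, 3}) := netEq_subst (by decide) (by decide)
  simpa using key.rename_open (O' := O) (val [a, b, v, w]) (by simp; omega)

lemma netEq_X_three_self (z w : ℕ) : NetEq E O (X 0 {z, w, w}) (X 0 {z}) := by
  have key :=
    calc NetEq E {0, 1} (X 0 {0, 1, 1}) (L 2 1 + X 0 {0, 1, 2}) :=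
        (netEq_subst (by decide) (by decide)).symm
      NetEq E {0, 1} _ (X 0 {1, 2} + X 0 {0, 1, 2}) := by
        rw [L_comm 2]
        exact .within (X 0 {0, 1, 2}) (netEq_X_two 1 2).symm
      NetEq E {0, 1} _ (X 0 {3} + X 0 {3, 1, 2} + X 0 {0, 1, 2}) :=
        .within (X 0 {0, 1, 2}) (by
          simpa using (netEq_X_fuse 0 0 (w := 3) (S := 0) (T := {1, 2}) (by decide) (by simp)
            (by decide)).symm)
      NetEq E {0, 1} _ (L 3 0 + X 0 {3} + X 0 {3, 1, 2}) :=
        .within (X 0 {3}) (netEq_bialgebra 3 0 1 2)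
      NetEq E {0, 1} _ (L 3 0 + (X 0 {2, 3, 1} + X 0 {3})) :=
        .of_eq (by rw [triple_rotate 2]; abel)
      NetEq E {0, 1} _ (X 0 {2, 0, 1} + X 0 {0}) := netEq_subst (by decide) (by decide)
      NetEq E {0, 1} _ (X 0 {0}) :=
        .within (X 0 {0}) (netEq_X_three_hidden (x := 2) (y := 0) (z := 1) (by decide) (by decide)
          (by decide))
  simpa using key.rename_open (O' := O) (val [z, w]) (by simp; grind)

lemma netEq_Z_absorb_red (α : Real.Angle) (x : ℕ) :
    NetEq E O (Z α {x} + X 0 {x}) (X 0 {x}) := by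
  have key :=
    calc NetEq E {0} (Z α {0} + X 0 {0}) (L 1 0 + (Z α {1} + X 0 {0})) :=
        (netEq_subst (by decide) (by decide)).symm
      NetEq E {0} _ (X 0 {0} + X 0 {1} + Z α {1}) := by
        rw [L_comm]
        exact .within (Z α {1}) (netEq_copy 0 1)
      NetEq E {0} _ (X 0 {0}) := .within (X 0 {0}) (netEq_Z_X_hidden α (x := 1) (by decide))
  simpa using key.rename_open (O' := O) (val [x]) (by simp)

lemma netEq_X_absorb_red (hα : α ≠ ang Real.pi) (x : ℕ) :
    NetEq E O (X α {x} + X 0 {x}) (X 0 {x}) := by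
  have key :=
    calc NetEq E {0} (X α {0} + X 0 {0}) (L 1 0 + (X α {1} + X 0 {0})) :=
        (netEq_subst (by decide) (by decide)).symm
      NetEq E {0} _ (X 0 {0} + X 0 {1} + X α {1}) := by
        rw [L_comm]
        exact .within (X α {1}) (netEq_copy 0 1)
      NetEq E {0} _ (X 0 {0}) :=
        .within (X 0 {0}) (netEq_X_X_hidden (α := α) (β := 0) (x := 1) (by simpa) (by decide))
  simpa using key.rename_open (O' := O) (val [x]) (by simp)

lemma netEq_X_two_hidden (α : Real.Angle) {x y : ℕ} (hx : x ∉ O) (hxy : x ≠ y) :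
    NetEq E O (X α {x, y}) 0 := by
  have key :=
    calc NetEq E {1} (X α {0, 1}) (X α {2} + X 0 {2, 0, 1}) := by
          simpa using (netEq_X_fuse α 0 (w := 2) (S := 0) (T := {0, 1}) (by decide) (by simp)
            (by decide)).symm
      NetEq E {1} _ (X 0 {0, 1, 2} + X α {2}) := .of_eq (by rw [triple_rotate 2]; abel)
      NetEq E {1} _ (X α {2}) := .within (X α {2}) (netEq_X_three_hidden (x := 0) (y := 1) (z := 2)
        (by simp) (by decide) (by decide))
      NetEq E {1} _ 0 := netEq_X_hidden α (by decide)
  simpa using key.rename_hidden (O' := O) (val [x, y]) 0 (by simp) (by simpa) (by simp [hxy.symm])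

/-! ### The vertex `H` -/

lemma netEq_H_H {a b w : ℕ} (hw : w ∉ O) (ha : a ≠ w) (hb : b ≠ w) :
    NetEq E O (H a w + H w b) (L a b) := by
  have key : NetEq E {0, 1} (H 0 2 + H 2 1) (L 0 1) := .of_ax (.had_had 0 1 2)
  simpa using key.rename_hidden (O' := O) (val [a, b, w]) 2 (by simp; omega) (by simpa)
    (by simp [ha, hb])

lemma netEq_H_X {a w : ℕ} (hw : w ∉ O) (ha : a ≠ w) : NetEq E O (H a w + X 0 {w}) 0 := by
  have key : NetEq E {0} (H 0 1 + X 0 {1}) (Z 0 {0}) := by exact .of_ax (.had_eps .red 0 1)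
  calc NetEq E O (H a w + X 0 {w}) (Z 0 {a}) := by
        simpa using key.rename_hidden (O' := O) (val [a, w]) 1 (by simp; omega) (by simpa)
          (by simp [ha])
    NetEq E O _ 0 := netEq_Z_zero a

lemma netEq_H_hidden {a w : ℕ} (hw : w ∉ O) (ha : a ≠ w) : NetEq E O (H a w) (X 0 {a}) := by
  have key : NetEq E {0} (H 0 1 + Z 0 {1}) (X 0 {0}) := by exact .of_ax (.had_eps .green 0 1)
  calc NetEq E O (H a w) (H a w + Z 0 {w}) := .within (H a w) (netEq_Z_zero w).symm
    NetEq E O _ (X 0 {a}) := by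
      simpa using key.rename_hidden (O' := O) (val [a, w]) 1 (by simp; omega) (by simpa)
        (by simp [ha])

lemma netEq_H_Z (α : Real.Angle) {a w : ℕ} (hw : w ∉ O) (ha : a ≠ w) :
    NetEq E O (H a w + Z α {w}) (X α {a}) := by
  have hphase : NetEq E {0, 2} (H 0 1 + Z α {1, 2}) (X α {0, 3} + H 3 2) := by
    exact .of_ax (.had_phase .green α 0 2 1 3)
  have key :=
    calc NetEq E {0} (H 0 1 + Z α {1}) (L 2 1 + (H 0 1 + Z α {1})) :=
        (netEq_subst (by decide) (by decide)).symm
      NetEq E {0} _ (H 0 1 + Z α {1, 2}) := by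
        rw [L_comm]
        exact .within (H 0 1) (by simpa using (netEq_Z_cons α 1 {2}).symm)
      NetEq E {0} _ (X α {0, 3} + H 3 2) := hphase.hide (by decide)
      NetEq E {0} _ (X α {3, 0} + X 0 {3}) := by
        rw [Multiset.pair_comm 0 3]
        exact .within (X α {3, 0}) (netEq_H_hidden (a := 3) (w := 2) (by simp) (by decide))
      NetEq E {0} _ (X α {0}) := by
        simpa using netEq_X_fuse α 0 (w := 3) (S := {0}) (T := 0) (by decide) (by decide) (by simp)
  simpa using key.rename_hidden (O' := O) (val [a, w]) 1 (by simp; omega) (by simpa) (by simp [ha])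

lemma netEq_H_add {s v w z : ℕ} (hz : z ∉ O) (hs : s ≠ z) (hv : v ≠ z) (hw : w ≠ z) :
    NetEq E O (H s v + H s w) (H s z + X 0 {z, v, w}) := by
  have hdelta : NetEq E {0, 1, 2} (H 0 3 + X 0 {3, 1, 2}) (Z 0 {0, 4, 5} + H 4 1 + H 5 2) := by
    exact .of_ax (.had_delta .red 0 1 2 4 5 3)
  have key :=
    calc NetEq E {0, 1, 2} (H 0 1 + H 0 2) (L 5 0 + (H 0 1 + H 5 2)) :=
        (netEq_subst (by decide) (by decide)).symm
      NetEq E {0, 1, 2} _ (L 4 0 + (L 5 0 + H 4 1 + H 5 2)) :=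
        (netEq_subst (by decide) (by decide)).symm
      NetEq E {0, 1, 2} _ (Z 0 {0, 4, 5} + H 4 1 + H 5 2) := by
        rw [L_comm 4, L_comm 5]
        exact .within (H 4 1 + H 5 2) (netEq_Z_three 0 4 5).symm
      NetEq E {0, 1, 2} _ (H 0 3 + X 0 {3, 1, 2}) := hdelta.symm
  simpa using key.rename_hidden (O' := O) (val [s, v, w, z]) 3 (by simp; omega) (by simpa)
    (by simp [hs, hv, hw])

lemma netEq_H_sq (v w : ℕ) : NetEq E O (H v w + H v w) 0 := by
  obtain ⟨k, hk, hkvw⟩ := exists_notMem_notMem_wires O (H v w)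
  simp only [wires_H, Multiset.insert_eq_cons, Multiset.mem_cons, Multiset.mem_singleton,
    not_or] at hkvw
  calc NetEq E O (H v w + H v w) (H v k + X 0 {k, w, w}) :=
      netEq_H_add hk (Ne.symm hkvw.1) (Ne.symm hkvw.2) (Ne.symm hkvw.2)
    NetEq E O _ (H v k + X 0 {k}) := .within (H v k) (netEq_X_three_self k w)
    NetEq E O _ 0 := netEq_H_X hk (Ne.symm hkvw.1)

lemma netEq_L_H (a b : ℕ) : NetEq E O (L a b + H a b) (L a b + H b b) := by
  have key :=
    calc NetEq E {0, 1} (L 0 1 + H 0 1) (L 2 0 + (L 2 1 + H 2 1)) :=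
        (netEq_subst (by decide) (by decide)).symm
      NetEq E {0, 1} _ (L 2 1 + (L 0 2 + H 2 1)) := .of_eq (by rw [L_comm 2 0]; abel)
      NetEq E {0, 1} _ (L 0 1 + H 1 1) := netEq_subst (by decide) (by decide)
  simpa using key.rename_open (O' := O) (val [a, b]) (by simp; omega)

/-- A red vertex with three legs makes each leg the sum of the two others; `H` is additive. -/
lemma netEq_H_X_three (y v w s : ℕ) :
    NetEq E O (H y s + X 0 {y, v, w}) (H v s + H w s + X 0 {y, v, w}) := by
  obtain ⟨k, hk, hkD⟩ := exists_notMem_notMem_wires O (H s y + H v w)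
  simp only [wires_add, wires_H, Multiset.mem_add, Multiset.insert_eq_cons, Multiset.mem_cons,
    Multiset.mem_singleton, not_or] at hkD
  obtain ⟨⟨hks, hky⟩, hkv, hkw⟩ := hkD
  refine .symm ?_
  calc NetEq E O (H v s + H w s + X 0 {y, v, w}) (H s k + X 0 {k, v, w} + X 0 {y, v, w}) := by
        rw [H_comm v s, H_comm w s]
        exact .within (X 0 {y, v, w}) (netEq_H_add (s := s) (v := v) (w := w) (z := k)
          (by simp; grind) (by grind) (by grind) (by grind))
    NetEq E O _ (L k y + X 0 {k, v, w} + H s k) := .within (H s k) (netEq_bialgebra k y v w)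
    NetEq E O _ (L k y + (H k s + X 0 {k, v, w})) := .of_eq (by rw [H_comm]; abel)
    NetEq E O _ (H y s + X 0 {y, v, w}) := netEq_subst hk hky (by
      simp [sub_of_ne (Ne.symm hks), sub_of_ne (Ne.symm hkv), sub_of_ne (Ne.symm hkw)])

end Rules

section Euler

/-! ### The Euler decomposition -/

variable {E : Set Equation} {O : Finset ℕ} {τ : Real.Angle}

/-- The Euler decomposition of `H` with all three angles equal to `τ`, as an equation between nets
with hidden variables. -/
def IsEulerAngle (E : Set Equation) (τ : Real.Angle) : Prop :=
  NetEq E {0, 1} (H 0 1) (Z τ {0} + X τ {0, 1} + Z τ {1})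

namespace IsEulerAngle

lemma netEq_H (h : IsEulerAngle E τ) (a b : ℕ) :
    NetEq E O (H a b) (Z τ {a} + X τ {a, b} + Z τ {b}) := by
  simpa using h.rename_open (O' := O) (val [a, b]) (by simp)

lemma netEq_X (h : IsEulerAngle E τ) (a b : ℕ) :
    NetEq E O (X τ {a, b}) (Z (-τ) {a} + H a b + Z (-τ) {b}) := by
  refine .symm ?_
  calc NetEq E O (Z (-τ) {a} + H a b + Z (-τ) {b})
        (Z τ {a} + Z (-τ) {a} + (Z τ {b} + Z (-τ) {b}) + X τ {a, b}) :=
      .within (Z (-τ) {a} + Z (-τ) {b}) (h.netEq_H a b)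
    NetEq E O _ (Z τ {b} + Z (-τ) {b} + X τ {a, b}) :=
      .within (Z τ {b} + Z (-τ) {b} + X τ {a, b}) (netEq_Z_cancel (add_neg_cancel τ) a)
    NetEq E O _ (X τ {a, b}) := .within (X τ {a, b}) (netEq_Z_cancel (add_neg_cancel τ) b)

lemma netEq_X_neg (h : IsEulerAngle E τ) :
    NetEq E {0, 1} (X (-τ) {0, 1}) (Z τ {0} + H 0 1 + Z τ {1}) := by
  refine .symm ?_
  calc NetEq E {0, 1} (Z τ {0} + H 0 1 + Z τ {1}) (L 2 1 + (Z τ {0} + H 0 2 + Z τ {2})) :=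
      (netEq_subst (by decide) (by decide)).symm
    NetEq E {0, 1} _ (X 0 {2, 1} + (Z τ {0} + H 0 2 + Z τ {2})) :=
      .within (Z τ {0} + H 0 2 + Z τ {2}) (netEq_X_two 2 1).symm
    NetEq E {0, 1} _ (X τ {3, 2} + X (-τ) {3, 1} + (Z τ {0} + H 0 2 + Z τ {2})) :=
      .within (Z τ {0} + H 0 2 + Z τ {2}) (by
        simpa using (netEq_X_fuse τ (-τ) (w := 3) (S := {2}) (T := {1}) (by simp) (by decide)
          (by decide)).symm)
    NetEq E {0, 1} _ (Z τ {2} + Z (-τ) {2} +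
        (Z (-τ) {3} + H 3 2 + X (-τ) {3, 1} + Z τ {0} + H 0 2)) :=
      .within (X (-τ) {3, 1} + (Z τ {0} + H 0 2 + Z τ {2})) (h.netEq_X 3 2)
    NetEq E {0, 1} _ (Z (-τ) {3} + H 3 2 + X (-τ) {3, 1} + Z τ {0} + H 2 0) := by
      rw [H_comm 2 0]
      exact .within (Z (-τ) {3} + H 3 2 + X (-τ) {3, 1} + Z τ {0} + H 0 2)
        (netEq_Z_cancel (add_neg_cancel τ) 2)
    NetEq E {0, 1} _ (L 3 0 + (Z (-τ) {3} + Z τ {0} + X (-τ) {3, 1})) :=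
      .within (Z (-τ) {3} + X (-τ) {3, 1} + Z τ {0})
        (netEq_H_H (a := 3) (w := 2) (b := 0) (by simp) (by decide) (by decide))
    NetEq E {0, 1} _ (Z (-τ) {0} + Z τ {0} + X (-τ) {0, 1}) :=
      netEq_subst (by decide) (by decide)
    NetEq E {0, 1} _ (X (-τ) {0, 1}) :=
      .within (X (-τ) {0, 1}) (netEq_Z_cancel (neg_add_cancel τ) 0)

lemma neg (h : IsEulerAngle E τ) : IsEulerAngle E (-τ) := by
  refine .symm ?_
  calc NetEq E {0, 1} (Z (-τ) {0} + X (-τ) {0, 1} + Z (-τ) {1})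
        (Z τ {0} + Z (-τ) {0} + (Z τ {1} + Z (-τ) {1}) + H 0 1) :=
      .within (Z (-τ) {0} + Z (-τ) {1}) (by simpa using h.netEq_X_neg)
    NetEq E {0, 1} _ (Z τ {1} + Z (-τ) {1} + H 0 1) :=
      .within (Z τ {1} + Z (-τ) {1} + H 0 1) (netEq_Z_cancel (add_neg_cancel τ) 0)
    NetEq E {0, 1} _ (H 0 1) := .within (H 0 1) (netEq_Z_cancel (add_neg_cancel τ) 1)

lemma netEq_X_one (h : IsEulerAngle E τ) (x : ℕ) : NetEq E O (X τ {x}) (Z (-τ) {x}) := by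
  obtain ⟨k, hk, hkx⟩ := exists_notMem_notMem_wires O (Z τ {x})
  simp only [wires_Z, Multiset.mem_singleton] at hkx
  refine .symm ?_
  calc NetEq E O (Z (-τ) {x}) (H x k + X 0 {k} + Z (-τ) {x}) :=
      .within (Z (-τ) {x}) (netEq_H_X (a := x) (w := k) (by simp [hk, hkx]) (Ne.symm hkx)).symm
    NetEq E O _ (Z τ {x} + X τ {x, k} + (Z τ {k} + X 0 {k}) + Z (-τ) {x}) :=
      .within (X 0 {k} + Z (-τ) {x}) (h.netEq_H x k)
    NetEq E O _ (Z τ {x} + Z (-τ) {x} + (X τ {k, x} + X 0 {k})) := by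
      rw [Multiset.pair_comm k x]
      exact .within (Z τ {x} + X τ {x, k} + Z (-τ) {x}) (netEq_Z_absorb_red τ k)
    NetEq E O _ (X τ {k, x} + X 0 {k}) :=
      .within (X τ {k, x} + X 0 {k}) (netEq_Z_cancel (add_neg_cancel τ) x)
    NetEq E O _ (X τ {x}) := by
      simpa using netEq_X_fuse τ 0 (w := k) (S := {x}) (T := 0) hk (by simpa) (by simp)

end IsEulerAngle

end Euler

section Path

/-! ### Local complementation of a path with three vertices -/

variable {E : Set Equation} {O : Finset ℕ} {τ : Real.Angle}

/-- Local complementation of the path `1 - 0 - 2` at its centre `0`, as an equation between nets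
with hidden variables: the variable `3` is the former output of the centre. -/
def PathComplementation (E : Set Equation) (τ : Real.Angle) : Prop :=
  NetEq E {0, 1, 2} (X (-τ) {0, 3} + H 3 1 + H 3 2 + Z τ {1} + Z τ {2}) (H 0 1 + H 0 2 + H 1 2)

lemma ne_pi_of_add_self (hτ : τ + τ = ang Real.pi) : τ ≠ ang Real.pi := by
  rintro rfl
  exact Real.Angle.pi_ne_zero (add_eq_left.1 hτ)

namespace PathComplementation

lemma netEq_H_self (h : PathComplementation E τ) (hτ : τ + τ = ang Real.pi) (x : ℕ) :
    NetEq E O (H x x) (Z (ang Real.pi) {x}) := by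
  have key :=
    calc NetEq E {0} (H 0 0) (L 2 0 + H 0 2) := (netEq_subst (by decide) (by decide)).symm
      NetEq E {0} _ (H 0 1 + H 1 2 + H 0 2) := by
        rw [L_comm]
        exact .within (H 0 2)
          (netEq_H_H (a := 0) (w := 1) (b := 2) (by simp) (by decide) (by decide)).symm
      NetEq E {0} _ (H 1 0 + H 1 2 + H 0 2) := .of_eq (by rw [H_comm 0 1])
      NetEq E {0} _ (X (-τ) {1, 3} + H 3 0 + H 3 2 + Z τ {0} + Z τ {2}) := by
        simpa using h.symm.rename_hidden (O' := {0}) (val [1, 0, 2, 3]) 3 (by simp; omega)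
          (by simp) (by simp)
      NetEq E {0} _ (H 0 3 + H 3 2 + (Z τ {0} + Z τ {2})) := by
        rw [H_comm 0 3]
        exact .within (H 3 0 + H 3 2 + Z τ {0} + Z τ {2})
          (netEq_X_two_hidden (-τ) (x := 1) (y := 3) (by simp) (by decide))
      NetEq E {0} _ (L 2 0 + (Z τ {0} + Z τ {2})) := by
        rw [L_comm]
        exact .within (Z τ {0} + Z τ {2})
          (netEq_H_H (a := 0) (w := 3) (b := 2) (by simp) (by decide) (by decide))
      NetEq E {0} _ (Z τ {0} + Z τ {0}) := netEq_subst (by decide) (by decide)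
      NetEq E {0} _ (Z (ang Real.pi) {0}) := hτ ▸ netEq_Z_add τ τ 0
  simpa using key.rename_open (O' := O) (val [x]) (by simp)

lemma netEq_X_H_X (h : PathComplementation E τ) (hτ : τ + τ = ang Real.pi) :
    NetEq E {0, 1} (X (-τ) {0, 3} + H 3 1 + X τ {3} + Z τ {1}) (L 0 1 + Z (ang Real.pi) {1}) :=
  calc NetEq E {0, 1} (X (-τ) {0, 3} + H 3 1 + X τ {3} + Z τ {1})
        (X (-τ) {0, 3} + H 3 1 + H 3 2 + Z τ {1} + Z τ {2}) :=
      .within (X (-τ) {0, 3} + H 3 1 + Z τ {1})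
        (netEq_H_Z τ (a := 3) (w := 2) (by simp) (by decide)).symm
    NetEq E {0, 1} _ (H 0 1 + H 0 2 + H 1 2) := h.hide (by decide)
    NetEq E {0, 1} _ (L 0 1 + H 0 1) := by
      rw [H_comm 1 2]
      exact .within (H 0 1) (netEq_H_H (a := 0) (w := 2) (b := 1) (by simp) (by decide) (by decide))
    NetEq E {0, 1} _ (L 0 1 + H 1 1) := netEq_L_H 0 1
    NetEq E {0, 1} _ (L 0 1 + Z (ang Real.pi) {1}) := .within (L 0 1) (h.netEq_H_self hτ 1)

lemma netEq_X_H (h : PathComplementation E τ) (hτ : τ + τ = ang Real.pi) (a b : ℕ) :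
    NetEq E O (X τ {a} + H a b) (Z τ {b} + X τ {a, b}) := by
  have hπ : ang Real.pi + -τ = τ := by rw [← hτ, add_neg_cancel_right]
  have key :=
    calc NetEq E {0, 1} (X τ {0} + H 0 1) (X τ {0} + (H 0 1 + (Z τ {1} + Z (-τ) {1}))) :=
        .within (X τ {0} + H 0 1) (netEq_Z_cancel (add_neg_cancel τ) 1).symm
      NetEq E {0, 1} _ (L 3 0 + (X τ {3} + H 3 1 + Z τ {1} + Z (-τ) {1})) :=
        (netEq_subst (by decide) (by decide)).symm
      NetEq E {0, 1} _ (X 0 {3, 0} + (X τ {3} + H 3 1 + Z τ {1} + Z (-τ) {1})) :=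
        .within (X τ {3} + H 3 1 + Z τ {1} + Z (-τ) {1}) (netEq_X_two 3 0).symm
      NetEq E {0, 1} _ (X (-τ) {2, 3} + X τ {2, 0} + (X τ {3} + H 3 1 + Z τ {1} + Z (-τ) {1})) :=
        .within (X τ {3} + H 3 1 + Z τ {1} + Z (-τ) {1}) (by
          simpa using (netEq_X_fuse (-τ) τ (w := 2) (S := {3}) (T := {0}) (by simp) (by decide)
            (by decide)).symm)
      NetEq E {0, 1} _ (L 2 1 + (Z (ang Real.pi) {1} + Z (-τ) {1} + X τ {2, 0})) :=
        .within (X τ {2, 0} + Z (-τ) {1}) (by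
          simpa using (h.netEq_X_H_X hτ).rename_hidden (val [2, 1, 0, 3]) 3
            (by simp; omega) (by simp) (by simp))
      NetEq E {0, 1} _ (Z (ang Real.pi) {1} + Z (-τ) {1} + X τ {1, 0}) :=
        netEq_subst (by decide) (by decide)
      NetEq E {0, 1} _ (Z τ {1} + X τ {0, 1}) := by
        rw [Multiset.pair_comm 0 1]
        exact .within (X τ {1, 0}) (hπ ▸ netEq_Z_add (ang Real.pi) (-τ) 1)
  simpa using key.rename_open (O' := O) (val [a, b]) (by simp)

lemma netEq_X_Z (h : PathComplementation E τ) (hτ : τ + τ = ang Real.pi) (x : ℕ) :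
    NetEq E O (X τ {x} + Z τ {x}) 0 := by
  have key :=
    calc NetEq E {0} (X τ {0} + Z τ {0}) (H 0 1 + X 0 {1} + (X τ {0} + Z τ {0})) :=
        .within (X τ {0} + Z τ {0}) (netEq_H_X (a := 0) (w := 1) (by simp) (by decide)).symm
      NetEq E {0} _ (Z τ {1} + X τ {0, 1} + X 0 {1} + Z τ {0}) :=
        .within (X 0 {1} + Z τ {0}) (h.netEq_X_H hτ 0 1)
      NetEq E {0} _ (X τ {1} + H 1 0 + (Z τ {1} + X 0 {1})) := by
        rw [Multiset.pair_comm 0 1]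
        exact .within (Z τ {1} + X 0 {1}) (h.netEq_X_H hτ 1 0).symm
      NetEq E {0} _ (X τ {1} + X 0 {1} + H 1 0) :=
        .within (X τ {1} + H 1 0) (netEq_Z_absorb_red τ 1)
      NetEq E {0} _ (H 0 1 + X 0 {1}) := by
        rw [H_comm 0 1]
        exact .within (H 1 0) (netEq_X_absorb_red (ne_pi_of_add_self hτ) 1)
      NetEq E {0} _ 0 := netEq_H_X (by decide) (by decide)
  simpa using key.rename_open (O' := O) (val [x]) (by simp)

lemma isEulerAngle (h : PathComplementation E τ) (hτ : τ + τ = ang Real.pi) : IsEulerAngle E τ :=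
  calc NetEq E {0, 1} (H 0 1) (X τ {0} + Z τ {0} + H 0 1) :=
      .within (H 0 1) (h.netEq_X_Z hτ 0).symm
    NetEq E {0, 1} _ (Z τ {0} + X τ {0, 1} + Z τ {1}) :=
      .within (Z τ {0}) (h.netEq_X_H hτ 0 1)

end PathComplementation

end Path

/-! ### Stars and complete graphs -/

section Sums

variable {E : Set Equation} {O : Finset ℕ} {ι V W W' : Type}

lemma netEq_sum {s : Finset ι} {F F' : ι → Net ℕ} (h : ∀ i ∈ s, ∀ O, NetEq E O (F i) (F' i)) :
    NetEq E O (∑ i ∈ s, F i) (∑ i ∈ s, F' i) := by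
  classical
  induction s using Finset.induction_on generalizing O with
  | empty => exact .refl O _
  | insert i s hi ih =>
    simp only [Finset.mem_insert, forall_eq_or_imp] at h
    rw [Finset.sum_insert hi, Finset.sum_insert hi]
    calc NetEq E O (F i + ∑ j ∈ s, F j) (F' i + ∑ j ∈ s, F j) :=
        .within (∑ j ∈ s, F j) (h.1 _)
      NetEq E O _ (F' i + ∑ j ∈ s, F' j) := .within (F' i) (ih h.2)

/-- The `H` on an edge of a graph whose vertices are named by `q`. -/
def edgeH (q : V → W) : Sym2 V → Net W :=
  Sym2.lift ⟨fun v w => H (q v) (q w), fun v w => H_comm (q v) (q w)⟩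

@[simp] lemma edgeH_mk (q : V → W) (v w : V) : edgeH q s(v, w) = H (q v) (q w) := rfl

@[simp] lemma rename_edgeH (f : W → W') (q : V → W) (e : Sym2 V) :
    (edgeH q e).rename f = edgeH (f ∘ q) e := by
  induction e using Sym2.ind with
  | _ v w => simp

@[simp] lemma hasArity_edgeH (q : V → W) (e : Sym2 V) : HasArity (edgeH q e) := by
  induction e using Sym2.ind with
  | _ v w => simp

@[simp] lemma mem_wires_edgeH {q : V → W} {e : Sym2 V} {x : W} :
    x ∈ wires (edgeH q e) ↔ ∃ v ∈ e, x = q v := by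
  induction e using Sym2.ind with
  | _ v w => simp

variable [DecidableEq V]

lemma netEq_edgeH_symmDiff (q : V → ℕ) (s t : Finset (Sym2 V)) :
    NetEq E O (∑ e ∈ s, edgeH q e + ∑ e ∈ t, edgeH q e) (∑ e ∈ symmDiff s t, edgeH q e) := by
  have hs := Finset.sum_inter_add_sum_sdiff s t (edgeH q)
  have ht := Finset.sum_inter_add_sum_sdiff t s (edgeH q)
  rw [symmDiff_def, Finset.sup_eq_union, Finset.sum_union disjoint_sdiff_sdiff, ← hs, ← ht,
    Finset.inter_comm t s]
  have hsq : NetEq E (O ∪ (wires (∑ e ∈ s \ t, edgeH q e + ∑ e ∈ t \ s, edgeH q e)).toFinset)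
      (∑ e ∈ s ∩ t, edgeH q e + ∑ e ∈ s ∩ t, edgeH q e) 0 := by
    rw [← Finset.sum_add_distrib]
    refine (netEq_sum fun e _ O => ?_).trans (.of_eq Finset.sum_const_zero)
    induction e using Sym2.ind with
    | _ v w => exact netEq_H_sq (q v) (q w)
  exact .within _ hsq

/-- The edges of the complete graph on `s`. -/
def pairs (s : Finset V) : Finset (Sym2 V) := s.sym2.filter fun e => ¬e.IsDiag

@[simp] lemma mk_mem_pairs {s : Finset V} {v w : V} :
    s(v, w) ∈ pairs s ↔ (v ∈ s ∧ w ∈ s) ∧ v ≠ w := by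
  simp [pairs]

@[simp] lemma pairs_empty : pairs (∅ : Finset V) = ∅ := by simp [pairs]

lemma sum_pairs_insert {M : Type} [AddCommMonoid M] (F : Sym2 V → M) {s : Finset V} {v : V}
    (hv : v ∉ s) :
    ∑ e ∈ pairs (insert v s), F e = ∑ w ∈ s, F s(v, w) + ∑ e ∈ pairs s, F e := by
  have hpairs : pairs (insert v s) = s.image (fun w => s(v, w)) ∪ pairs s := by
    ext e
    induction e using Sym2.ind with
    | _ x y =>
      simp only [mk_mem_pairs, Finset.mem_union, Finset.mem_image, Finset.mem_insert, Sym2.eq_iff]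
      grind
  have hdisj : Disjoint (s.image fun w => s(v, w)) (pairs s) := by
    simp only [Finset.disjoint_left, Finset.mem_image]
    rintro _ ⟨w, -, rfl⟩ h
    exact hv (mk_mem_pairs.1 h).1.1
  rw [hpairs, Finset.sum_union hdisj, Finset.sum_image fun w _ w' _ h => Sym2.congr_right.1 h]

end Sums

section Star

variable {E : Set Equation} {O : Finset ℕ} {τ : Real.Angle} {V : Type} [DecidableEq V]
  {q : V → ℕ} {l : Finset V}

omit [DecidableEq V] in
lemma netEq_sum_H_X_three (y v w : ℕ) :
    NetEq E O (∑ i ∈ l, H y (q i) + X 0 {y, v, w})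
      (∑ i ∈ l, H v (q i) + ∑ i ∈ l, H w (q i) + X 0 {y, v, w}) := by
  classical
  induction l using Finset.induction_on generalizing O with
  | empty => exact .of_eq (by simp)
  | insert j l hj ih =>
    simp only [Finset.sum_insert hj]
    calc NetEq E O (H y (q j) + ∑ i ∈ l, H y (q i) + X 0 {y, v, w})
          (H v (q j) + H w (q j) + X 0 {y, v, w} + ∑ i ∈ l, H y (q i)) :=
        .within (∑ i ∈ l, H y (q i)) (netEq_H_X_three y v w (q j))
      NetEq E O _ (H v (q j) + ∑ i ∈ l, H v (q i) + (H w (q j) + ∑ i ∈ l, H w (q i)) +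
          X 0 {y, v, w}) :=
        .within (H v (q j) + H w (q j)) ih

lemma IsEulerAngle.netEq_star (h : IsEulerAngle E τ) {m y : ℕ} (hm : m ∉ O) (hmy : m ≠ y)
    (hq : ∀ i ∈ l, q i ≠ m) :
    NetEq E O (Z τ {m} + H m y + ∑ i ∈ l, H m (q i))
      (Z (-τ) {y} + ∑ i ∈ l, Z (-τ) {q i} + ∑ i ∈ l, H y (q i) + ∑ e ∈ pairs l, edgeH q e) := by
  induction l using Finset.induction_on generalizing O m y with
  | empty =>
    simp only [Finset.sum_empty, add_zero, pairs_empty]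
    rw [H_comm, add_comm]
    exact (netEq_H_Z τ hm (Ne.symm hmy)).trans (h.netEq_X_one y)
  | insert w l hw ih =>
    simp only [Finset.mem_insert, forall_eq_or_imp] at hq
    simp only [Finset.sum_insert hw, sum_pairs_insert _ hw, edgeH_mk]
    let F := ∑ i ∈ l, Z (-τ) {q i} + ∑ e ∈ pairs l, edgeH q e
    let S := ∑ i ∈ l, H y (q i) + ∑ i ∈ l, H (q w) (q i)
    obtain ⟨k, hk, hkD⟩ := exists_notMem_notMem_wires O (H m y + H y (q w) + (F + S))
    simp only [wires_add, wires_H, Multiset.mem_add, Multiset.insert_eq_cons, Multiset.mem_cons,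
      Multiset.mem_singleton, not_or] at hkD
    obtain ⟨⟨⟨hkm, hky⟩, -, hkw⟩, hkF, hkS⟩ := hkD
    have hkq : ∀ i ∈ l, k ≠ q i := by simp [S] at hkS; grind
    calc NetEq E O (Z τ {m} + H m y + (H m (q w) + ∑ i ∈ l, H m (q i)))
          (Z τ {m} + H m k + ∑ i ∈ l, H m (q i) + X 0 {k, y, q w}) :=
        .within (Z τ {m} + ∑ i ∈ l, H m (q i)) (netEq_H_add (z := k)
          (by simp [hk, hkm]; grind) (Ne.symm hkm) (Ne.symm hky) (Ne.symm hkw))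
      NetEq E O _ (∑ i ∈ l, H k (q i) + X 0 {k, y, q w} + (Z (-τ) {k} + F)) :=
        .within (X 0 {k, y, q w})
          (ih (m := m) (y := k) (by simp [hm, hmy, Ne.symm hkm, Ne.symm hq.1]) (Ne.symm hkm) hq.2)
          (hB := by simp only [F, Multiset.insert_eq_cons]; abel)
      NetEq E O _ (Z (-τ) {k} + (X 0 {k, y, q w} + F + S)) :=
        .within (Z (-τ) {k} + F) (netEq_sum_H_X_three k y (q w))
          (hB := by simp only [S, Multiset.insert_eq_cons]; abel)
      NetEq E O _ (X τ {k} + X 0 {k, y, q w} + (F + S)) :=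
        .within (X 0 {k, y, q w} + F + S) (h.netEq_X_one k).symm
      NetEq E O _ (X τ {y, q w} + (F + S)) :=
        .within (F + S) (by
          simpa using netEq_X_fuse τ 0 (w := k) (S := 0) (T := {y, q w}) (by simp [hk, hkF, hkS])
            (by simp) (by simp [hky, hkw]))
      NetEq E O _ _ := .within (F + S) (h.netEq_X y (q w)) (hB := by simp only [F, S]; abel)

omit [DecidableEq V] in
lemma netEq_sum_Z_cancel {α β : Real.Angle} (h : α + β = 0) :
    NetEq E O (∑ i ∈ l, Z α {q i} + ∑ i ∈ l, Z β {q i}) 0 := by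
  rw [← Finset.sum_add_distrib]
  exact (netEq_sum fun i _ _ => netEq_Z_cancel h (q i)).trans (.of_eq Finset.sum_const_zero)

lemma IsEulerAngle.netEq_X_star (h : IsEulerAngle E τ) {o m : ℕ} (hm : m ∉ O) (hmo : m ≠ o)
    (hq : ∀ i ∈ l, q i ≠ m) :
    NetEq E O (X (-τ) {o, m} + ∑ i ∈ l, H m (q i) + ∑ i ∈ l, Z τ {q i})
      (∑ i ∈ l, H o (q i) + ∑ e ∈ pairs l, edgeH q e) :=
  calc NetEq E O (X (-τ) {o, m} + ∑ i ∈ l, H m (q i) + ∑ i ∈ l, Z τ {q i})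
        (Z τ {o} + ∑ i ∈ l, Z τ {q i} + (Z τ {m} + H m o + ∑ i ∈ l, H m (q i))) := by
        rw [H_comm m o]
        exact .within (∑ i ∈ l, H m (q i) + ∑ i ∈ l, Z τ {q i})
          (by simpa only [neg_neg] using h.neg.netEq_X o m)
    NetEq E O _ (Z τ {o} + Z (-τ) {o} + (∑ i ∈ l, Z τ {q i} + ∑ i ∈ l, Z (-τ) {q i}) +
        (∑ i ∈ l, H o (q i) + ∑ e ∈ pairs l, edgeH q e)) :=
      .within (Z τ {o} + ∑ i ∈ l, Z τ {q i}) (h.netEq_star (by simp [hm, hmo]; grind) hmo hq)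
    NetEq E O _ (∑ i ∈ l, Z τ {q i} + ∑ i ∈ l, Z (-τ) {q i} +
        (∑ i ∈ l, H o (q i) + ∑ e ∈ pairs l, edgeH q e)) :=
      .within (∑ i ∈ l, Z τ {q i} + ∑ i ∈ l, Z (-τ) {q i} +
        (∑ i ∈ l, H o (q i) + ∑ e ∈ pairs l, edgeH q e)) (netEq_Z_cancel (add_neg_cancel τ) o)
    NetEq E O _ (∑ i ∈ l, H o (q i) + ∑ e ∈ pairs l, edgeH q e) :=
      .within (∑ i ∈ l, H o (q i) + ∑ e ∈ pairs l, edgeH q e)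
        (netEq_sum_Z_cancel (add_neg_cancel τ))

end Star

/-! ### Graph states -/

section Subst

variable {E : Set Equation} {O : Finset ℕ} {W : Type} [DecidableEq W]

lemma netEq_subst_sum (ν : W ↪ ℕ) (ψ : W → W) {S : Finset W} (hO : ∀ z ∈ S, ν z ∉ O)
    (hψ : ∀ z ∈ S, ψ z ∉ S) (C : Net W) :
    NetEq E O ((∑ z ∈ S, L z (ψ z) + C).rename ν)
      ((C.rename fun z => if z ∈ S then ψ z else z).rename ν) := by
  induction S using Finset.induction_on generalizing C with
  | empty => exact .of_eq (by rw [rename_eq_self (f := fun z => if z ∈ ∅ then ψ z else z)] <;> simp)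
  | insert s S hs ih =>
    simp only [Finset.mem_insert, not_or, forall_eq_or_imp] at hO hψ
    obtain ⟨⟨hss, hsS⟩, hψ⟩ := hψ
    have hsub : sub (ν s) (ν (ψ s)) ∘ ν = ν ∘ Function.update id s (ψ s) := by
      ext z
      by_cases hz : z = s <;> simp [sub, hz]
    have hC : C.rename (fun z => if z ∈ insert s S then ψ z else z) =
        (C.rename (Function.update id s (ψ s))).rename (fun z => if z ∈ S then ψ z else z) := by
      rw [rename_rename]
      congr 1
      grind
    have hL : ∀ z ∈ S, (L z (ψ z)).rename (Function.update id s (ψ s)) = L z (ψ z) := by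
      grind [rename_L]
    calc NetEq E O ((∑ z ∈ insert s S, L z (ψ z) + C).rename ν)
          (L (ν s) (ν (ψ s)) + (∑ z ∈ S, L z (ψ z) + C).rename ν) :=
        .of_eq (by rw [Finset.sum_insert hs, add_assoc, rename_add, rename_L])
      NetEq E O _ ((∑ z ∈ S, L z (ψ z) + C.rename (Function.update id s (ψ s))).rename ν) :=
        netEq_subst hO.1 (ν.injective.ne (Ne.symm hss)) (by
          rw [rename_rename, hsub, ← rename_rename, rename_add (Function.update _ _ _), rename_sum,
            Finset.sum_congr rfl hL])
      NetEq E O _ _ := hC ▸ ih hO.2 (fun z hz => (hψ z hz).2) _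

end Subst

section GraphState

open scoped Classical

variable {E : Set Equation} {O : Finset ℕ} {ι V W : Type} [Fintype V] (G : SimpleGraph V)

/-- The neighbours of a vertex; adjacency is decided classically, so that no instance enters the
statements. -/
noncomputable def nbrs (v : V) : Finset V := Finset.univ.filter fun w => G.Adj v w

/-- The wires between the dots of a graph state and the `H`s on its edges. -/
noncomputable def halves : Finset (Wire V) :=
  (Finset.univ.filter fun p : V × V => G.Adj p.1 p.2).image fun p => .half p.1 p.2

variable {G}

@[simp] lemma mem_nbrs {v w : V} : w ∈ nbrs G v ↔ G.Adj v w := by simp [nbrs]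

@[simp] lemma half_mem_halves {v w : V} : .half v w ∈ halves G ↔ G.Adj v w := by simp [halves]

@[simp] lemma out_notMem_halves {v : V} : .out v ∉ halves G := by simp [halves]

@[simp] lemma mid_notMem_halves {v : V} : .mid v ∉ halves G := by simp [halves]

lemma sum_halves {M : Type} [AddCommMonoid M] (F : Wire V → M) :
    ∑ z ∈ halves G, F z = ∑ v, ∑ w ∈ nbrs G v, F (.half v w) := by
  rw [halves, Finset.sum_image (by simp +contextual [Set.InjOn])]
  simp [nbrs, Finset.sum_filter, Fintype.sum_prod_type]

lemma map_val_eq_sum (s : Finset ι) (f : ι → W) : s.val.map f = ∑ i ∈ s, {f i} := by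
  rw [Finset.sum, ← Multiset.sum_map_singleton (s.val.map f), Multiset.map_map]
  rfl

lemma graphState_eq_sum (G : SimpleGraph V) (o : V → Wire V) :
    graphState G o = ∑ v, Z 0 (o v ::ₘ (nbrs G v).val.map (.half v)) +
      ∑ e ∈ G.edgeFinset, {edgeHad e} := by
  simp only [graphState, map_val_eq_sum]
  rfl

lemma netEq_graphState (ν : Wire V ↪ ℕ) (o : V → Wire V) (hO : ∀ z ∈ halves G, ν z ∉ O)
    (ho : ∀ v, o v ∉ halves G) :
    NetEq E O ((graphState G o).rename ν) (∑ e ∈ G.edgeFinset, edgeH (ν ∘ o) e) := by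
  let ψ : Wire V → Wire V
    | .half v _ => o v
    | z => z
  have hψ : ∀ z ∈ halves G, ψ z ∉ halves G
    | .out v, hz | .mid v, hz => by simp at hz
    | .half v _, _ => ho v
  calc NetEq E O ((graphState G o).rename ν)
        (∑ v, ∑ w ∈ nbrs G v, L (ν (.half v w)) (ν (o v)) +
          ∑ e ∈ G.edgeFinset, ({edgeHad e} : Net (Wire V)).rename ν) := by
        rw [graphState_eq_sum, rename_add, rename_sum, rename_sum]
        refine .within (∑ e ∈ G.edgeFinset, ({edgeHad e} : Net (Wire V)).rename ν)
          (netEq_sum (F' := fun v => ∑ w ∈ nbrs G v, L (ν (.half v w)) (ν (o v))) fun v _ O => ?_)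
        rw [rename_Z, Multiset.map_cons]
        refine (netEq_Z_cons 0 _ _).trans (.within (D' := 0) _ (netEq_Z_zero _) rfl ?_)
        rw [zero_add, Multiset.map_map, Multiset.map_map]
        exact Finset.sum_congr rfl fun w _ => L_comm _ _
    NetEq E O _ ((∑ z ∈ halves G, L z (ψ z) + ∑ e ∈ G.edgeFinset, {edgeHad e}).rename ν) :=
      .of_eq (by simp [sum_halves, ψ])
    NetEq E O _ _ := netEq_subst_sum ν ψ hO hψ _
    NetEq E O _ _ := .of_eq (by
      rw [rename_rename, rename_sum]
      refine Finset.sum_congr rfl fun e he => ?_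
      induction e using Sym2.ind with
      | _ v w =>
        have hvw : G.Adj v w := G.mem_edgeFinset.1 he
        change (H (Wire.half v w) (Wire.half w v)).rename _ = _
        simp [hvw, hvw.symm, ψ])

lemma rotatedGraphState_eq_sum (G : SimpleGraph V) (u : V) (θ : ℝ) :
    rotatedGraphState G u θ =
      graphState G (fun v => if v = u ∨ G.Adj u v then .mid v else .out v) +
        (X (ang θ) {Wire.out u, .mid u} + ∑ v ∈ nbrs G u, Z (ang (-θ)) {Wire.out v, .mid v}) := by
  rw [← add_assoc, rotatedGraphState, map_val_eq_sum]
  rfl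

lemma netEq_rotatedGraphState_gates (ν : Wire V ↪ ℕ) (u : V) (θ : ℝ)
    (hhalf : ∀ v w, ν (.half v w) ∉ O) :
    NetEq E O ((rotatedGraphState G u θ).rename ν)
      (∑ e ∈ G.edgeFinset, edgeH (ν ∘ fun v => if v = u ∨ G.Adj u v then .mid v else .out v) e +
        X (ang θ) {ν (.out u), ν (.mid u)} +
        ∑ v ∈ nbrs G u, Z (ang (-θ)) {ν (.out v), ν (.mid v)}) := by
  rw [rotatedGraphState_eq_sum, rename_add, rename_add, rename_sum]
  simp only [rename_Z, rename_X, Multiset.insert_eq_cons, Multiset.map_cons,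
    Multiset.map_singleton]
  refine .within (X (ang θ) {ν (.out u), ν (.mid u)} +
    ∑ v ∈ nbrs G u, Z (ang (-θ)) {ν (.out v), ν (.mid v)}) (netEq_graphState ν _ ?_ ?_) rfl
    (add_assoc _ _ _).symm
  · simp only [halves, Finset.mem_image, Finset.mem_filter, Finset.mem_univ, true_and, Prod.exists,
      Multiset.insert_eq_cons, wires_add, wires_X, wires_sum, wires_Z, Multiset.cons_add,
      Multiset.singleton_add, Multiset.toFinset_cons, Finset.union_insert, Finset.mem_insert,
      EmbeddingLike.apply_eq_iff_eq, Finset.mem_union, Multiset.mem_toFinset, Multiset.mem_sum,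
      mem_nbrs, Multiset.mem_cons, Multiset.mem_singleton, not_or, not_exists, not_and,
      forall_exists_index, and_imp]
    grind
  · grind [out_notMem_halves, mid_notMem_halves]

/-- The wire at the dot of `v` on the side of the outputs, when a gate is attached to the output
of `u` only. -/
noncomputable def port (u v : V) : Wire V := if v = u then .mid v else .out v

lemma netEq_rotatedGraphState (ν : Wire V ↪ ℕ) (u : V) (θ : ℝ)
    (hmid : ∀ v, ν (.mid v) ∉ O) (hhalf : ∀ v w, ν (.half v w) ∉ O) :
    NetEq E O ((rotatedGraphState G u θ).rename ν)
      (X (ang θ) {ν (.out u), ν (.mid u)} + ∑ v ∈ nbrs G u, Z (ang (-θ)) {ν (.out v)} +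
        ∑ e ∈ G.edgeFinset, edgeH (ν ∘ port u) e) := by
  let o (v : V) : Wire V := if v = u ∨ G.Adj u v then .mid v else .out v
  let ψ : Wire V → Wire V
    | .mid v => .out v
    | z => z
  let S : Finset (Wire V) := (nbrs G u).image Wire.mid
  have hport : (fun z => if z ∈ S then ψ z else z) ∘ o = port u := by
    ext v : 1
    by_cases hv : v = u
    · simp [S, o, port, hv]
    · by_cases huv : G.Adj u v <;> simp [S, ψ, o, port, hv, huv]
  let R : Net (Wire V) := X (ang θ) {Wire.out u, .mid u}
  let F : Net (Wire V) := ∑ e ∈ G.edgeFinset, edgeH o e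
  calc NetEq E O ((rotatedGraphState G u θ).rename ν)
        (F.rename ν + R.rename ν + ∑ v ∈ nbrs G u, Z (ang (-θ)) {ν (.out v), ν (.mid v)}) := by
        simpa only [F, R, rename_sum, rename_edgeH, rename_X, Multiset.insert_eq_cons,
          Multiset.map_cons, Multiset.map_singleton] using netEq_rotatedGraphState_gates ν u θ hhalf
    NetEq E O _ (F.rename ν + R.rename ν + ∑ v ∈ nbrs G u,
        (Z (ang (-θ)) {ν (.out v)} + L (ν (.mid v)) (ν (.out v)))) := by
        refine .within (F.rename ν + R.rename ν) (netEq_sum (F' := fun v =>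
          Z (ang (-θ)) {ν (.out v)} + L (ν (.mid v)) (ν (.out v))) fun v _ O => ?_)
        rw [L_comm]
        exact netEq_Z_cons (ang (-θ)) (ν (.out v)) {ν (.mid v)}
    NetEq E O _ ((∑ z ∈ S, L z (ψ z) +
        (R + ∑ v ∈ nbrs G u, Z (ang (-θ)) {Wire.out v} + F)).rename ν) := by
        refine .of_eq ?_
        have hS : ∑ z ∈ S, L z (ψ z) = ∑ v ∈ nbrs G u, L (Wire.mid v) (.out v) :=
          Finset.sum_image fun _ _ _ _ => Wire.mid.inj
        simp only [hS, rename_add, rename_sum, rename_L, rename_Z, Multiset.map_singleton,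
          Finset.sum_add_distrib]
        abel
    NetEq E O _ _ := netEq_subst_sum ν ψ (by simp [S, hmid]) (by simp [S, ψ]) _
    NetEq E O _ _ := .of_eq (by
      simp only [F, R, rename_add, rename_sum, rename_edgeH, hport]
      simp [S])

end GraphState

section OpenEnds

open scoped Classical

variable {V : Type} [Fintype V] {G : SimpleGraph V}

lemma sum_legs_edgeHad (G : SimpleGraph V) :
    ∑ e ∈ G.edgeFinset, (edgeHad e).legs = (halves G).val := by
  have hmaps : ∀ p ∈ Finset.univ.filter fun p : V × V => G.Adj p.1 p.2,
      s(p.1, p.2) ∈ G.edgeFinset := by simp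
  have hval : (halves G).val =
      ∑ p : V × V with G.Adj p.1 p.2, ({Wire.half p.1 p.2} : Multiset (Wire V)) := by
    rw [← Multiset.map_id (halves G).val, map_val_eq_sum, halves,
      Finset.sum_image (by simp +contextual [Set.InjOn])]
    rfl
  rw [hval, ← Finset.sum_fiberwise_of_maps_to hmaps]
  refine Finset.sum_congr rfl fun e he => ?_
  induction e using Sym2.ind with
  | _ v w =>
    have hvw : G.Adj v w := G.mem_edgeFinset.1 he
    have hfiber : ((Finset.univ.filter fun p : V × V => G.Adj p.1 p.2).filter
        fun p => s(p.1, p.2) = s(v, w)) = {(v, w), (w, v)} := by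
      ext ⟨a, b⟩
      simp only [Finset.mem_filter, Finset.mem_univ, true_and, Sym2.eq_iff, Finset.mem_insert,
        Finset.mem_singleton, Prod.mk.injEq]
      grind [G.adj_comm]
    rw [hfiber, Finset.sum_pair (by simp [hvw.ne])]
    rfl

lemma wires_graphState (G : SimpleGraph V) (o : V → Wire V) :
    wires (graphState G o) = ∑ v, {o v} + ((halves G).val + (halves G).val) := by
  have hhalves : ∑ v, (nbrs G v).val.map (Wire.half v) = (halves G).val := by
    simp only [map_val_eq_sum]
    rw [← sum_halves fun z => ({z} : Multiset (Wire V)), ← map_val_eq_sum]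
    exact Multiset.map_id _
  simp only [graphState_eq_sum, wires_add, wires_sum, wires_Z, wires_singleton, sum_legs_edgeHad,
    ← Multiset.singleton_add, Finset.sum_add_distrib, hhalves]
  abel

lemma hasArity_graphState (G : SimpleGraph V) (o : V → Wire V) : HasArity (graphState G o) := by
  simp only [graphState_eq_sum, hasArity_add, hasArity_sum, hasArity_Z, implies_true, true_and]
  intro e _
  induction e using Sym2.ind with
  | _ v w => exact hasArity_H _ _

/-- The names of the outputs of a graph state. -/
def outs (ν : Wire V ↪ ℕ) : Finset ℕ := Finset.univ.image fun v => ν (.out v)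

lemma apply_mem_outs {ν : Wire V ↪ ℕ} {z : Wire V} : ν z ∈ outs ν ↔ ∃ v, z = .out v := by
  simp [outs, eq_comm]

lemma hasOpenEnds_rename {ν : Wire V ↪ ℕ} {D : Net (Wire V)} (ha : HasArity D)
    {M : Finset (Wire V)} (hM : ∀ v, .out v ∉ M)
    (hD : wires D = ∑ v, {.out v} + (M.val + M.val)) : HasOpenEnds (D.rename ν) (outs ν) := by
  have hinj : Function.Injective fun v => ν (Wire.out v) :=
    ν.injective.comp fun _ _ => Wire.out.inj
  have houts : (outs ν).val = Finset.univ.val.map fun v => ν (.out v) :=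
    Finset.image_val_of_injOn hinj.injOn
  refine hasOpenEnds_of_wires (M := M.val.map ν) (hasArity_rename.2 ha) ?_ ?_
  · refine Multiset.nodup_add.2 ⟨M.nodup.map ν.injective, (outs ν).nodup,
      Multiset.disjoint_left.2 fun {x} hx hxO => ?_⟩
    obtain ⟨z, hz, rfl⟩ := Multiset.mem_map.1 hx
    obtain ⟨v, rfl⟩ := apply_mem_outs.1 hxO
    exact hM v hz
  · rw [wires_rename, hD, houts, ← map_val_eq_sum, Multiset.map_add, Multiset.map_add,
      Multiset.map_map]
    rfl

lemma hasOpenEnds_graphState (G : SimpleGraph V) (ν : Wire V ↪ ℕ) :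
    HasOpenEnds ((graphState G .out).rename ν) (outs ν) :=
  hasOpenEnds_rename (hasArity_graphState G _) (by simp) (wires_graphState G _)

lemma hasOpenEnds_rotatedGraphState (G : SimpleGraph V) (u : V) (θ : ℝ) (ν : Wire V ↪ ℕ) :
    HasOpenEnds ((rotatedGraphState G u θ).rename ν) (outs ν) := by
  let N := insert u (nbrs G u)
  have hdisj : Disjoint (halves G) (N.image Wire.mid) := by
    simp only [Finset.disjoint_right, Finset.forall_mem_image]
    simp
  have hmids : (N.image Wire.mid).val = ∑ v ∈ N, {Wire.mid v} := by
    rw [Finset.image_val_of_injOn (by simp [Set.InjOn]), map_val_eq_sum]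
  have hports : ∑ v, ({if v = u ∨ G.Adj u v then .mid v else .out v} : Multiset (Wire V)) +
      ∑ v ∈ N, {Wire.out v} = ∑ v, {Wire.out v} + (N.image Wire.mid).val := by
    rw [hmids, ← Finset.sum_add_sum_compl N, ← Finset.sum_add_sum_compl N fun v => {Wire.out v},
      Finset.sum_congr (s₁ := N) rfl fun v hv => by rw [if_pos (by simpa [N] using hv)],
      Finset.sum_congr (s₁ := Nᶜ) rfl fun v hv => by rw [if_neg (by simpa [N] using hv)]]
    abel
  have hgates : ({Wire.out u, .mid u} + ∑ v ∈ nbrs G u, {Wire.out v, .mid v} : Multiset _) =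
      ∑ v ∈ N, {Wire.out v} + (N.image Wire.mid).val := by
    rw [hmids, ← Finset.sum_add_distrib, Finset.sum_insert (by simp)]
    rfl
  refine hasOpenEnds_rename (M := (halves G).disjUnion _ hdisj)
    (by simp [rotatedGraphState_eq_sum, hasArity_graphState]) (by simp) ?_
  simp only [rotatedGraphState_eq_sum, wires_add, wires_sum, wires_graphState, wires_X, wires_Z,
    hgates, Finset.disjUnion_val]
  rw [← add_assoc, add_right_comm _ (_ + _), hports]
  abel

end OpenEnds

/-! ### Local complementation -/

section LocalComplement

open scoped Classical

variable {E : Set Equation} {V : Type} [Fintype V] [DecidableEq V] {G : SimpleGraph V} {u : V}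

/-- The edges of a graph which do not contain a given vertex. -/
noncomputable def farEdges (G : SimpleGraph V) (u : V) : Finset (Sym2 V) :=
  G.edgeFinset.filter fun e => u ∉ e

@[simp] lemma mk_mem_farEdges {v w : V} :
    s(v, w) ∈ farEdges G u ↔ G.Adj v w ∧ u ≠ v ∧ u ≠ w := by
  simp [farEdges]

lemma sum_edgeFinset {M : Type} [AddCommMonoid M] (F : Sym2 V → M) :
    ∑ e ∈ G.edgeFinset, F e = ∑ v ∈ nbrs G u, F s(u, v) + ∑ e ∈ farEdges G u, F e := by
  have hnear : G.edgeFinset.filter (u ∈ ·) = (nbrs G u).image fun v => s(u, v) := by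
    ext e
    induction e using Sym2.ind with
    | _ v w =>
      simp only [Finset.mem_filter, SimpleGraph.mem_edgeFinset, SimpleGraph.mem_edgeSet,
        Sym2.mem_iff, Finset.mem_image, mem_nbrs, Sym2.eq_iff]
      grind [G.adj_comm]
  rw [← Finset.sum_filter_add_sum_filter_not G.edgeFinset (u ∈ ·), hnear,
    Finset.sum_image fun v _ w _ h => Sym2.congr_right.1 h, farEdges]

omit [DecidableEq V] in
lemma nbrs_localComplement : nbrs (localComplement G u) u = nbrs G u := by
  ext v
  have := G.irrefl (v := u)
  have := G.ne_of_adj (a := u) (b := v)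
  simp only [mem_nbrs, localComplement, Xor]
  tauto

lemma farEdges_localComplement :
    farEdges (localComplement G u) u = symmDiff (farEdges G u) (pairs (nbrs G u)) := by
  ext e
  induction e using Sym2.ind with
  | _ v w =>
    have := G.ne_of_adj (a := v) (b := w)
    have := G.ne_of_adj (a := u) (b := v)
    have := G.ne_of_adj (a := u) (b := w)
    simp only [mk_mem_farEdges, localComplement, Xor, Finset.mem_symmDiff, mk_mem_pairs, mem_nbrs]
    tauto

lemma netEq_rotatedGraphState_nbrs (ν : Wire V ↪ ℕ) (θ : ℝ) :
    NetEq E (outs ν) ((rotatedGraphState G u θ).rename ν)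
      (X (ang θ) {ν (.out u), ν (.mid u)} + ∑ v ∈ nbrs G u, H (ν (.mid u)) (ν (.out v)) +
        ∑ v ∈ nbrs G u, Z (ang (-θ)) {ν (.out v)} +
        ∑ e ∈ farEdges G u, edgeH (ν ∘ Wire.out) e) := by
  have hnear : ∑ v ∈ nbrs G u, H (ν (.mid u)) (ν (.out v)) =
      ∑ v ∈ nbrs G u, edgeH (ν ∘ port u) s(u, v) :=
    Finset.sum_congr rfl fun v hv => by simp [port, (mem_nbrs.1 hv).ne']
  have hfar : ∑ e ∈ farEdges G u, edgeH (ν ∘ Wire.out) e =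
      ∑ e ∈ farEdges G u, edgeH (ν ∘ port u) e := by
    refine Finset.sum_congr rfl fun e he => ?_
    induction e using Sym2.ind with
    | _ v w =>
      obtain ⟨-, hv, hw⟩ := mk_mem_farEdges.1 he
      simp [port, hv.symm, hw.symm]
  refine (netEq_rotatedGraphState ν u θ (by simp [apply_mem_outs])
    (by simp [apply_mem_outs])).trans (.of_eq ?_)
  rw [sum_edgeFinset (u := u), ← hnear, ← hfar]
  abel

lemma netEq_graphState_localComplement (ν : Wire V ↪ ℕ) :
    NetEq E (outs ν) ((graphState (localComplement G u) .out).rename ν)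
      (∑ v ∈ nbrs G u, H (ν (.out u)) (ν (.out v)) +
        ∑ e ∈ symmDiff (farEdges G u) (pairs (nbrs G u)), edgeH (ν ∘ Wire.out) e) := by
  refine (netEq_graphState ν .out (fun z hz hO => ?_) (by simp)).trans (.of_eq ?_)
  · obtain ⟨v, rfl⟩ := apply_mem_outs.1 hO
    exact out_notMem_halves hz
  · rw [sum_edgeFinset (u := u), nbrs_localComplement, farEdges_localComplement]
    rfl

lemma derivable_localComplement_iff (ν : Wire V ↪ ℕ) (θ : ℝ) :
    Derivable E ((rotatedGraphState G u θ).rename ν)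
        ((graphState (localComplement G u) .out).rename ν) ↔
      NetEq E (outs ν)
        (X (ang θ) {ν (.out u), ν (.mid u)} + ∑ v ∈ nbrs G u, H (ν (.mid u)) (ν (.out v)) +
          ∑ v ∈ nbrs G u, Z (ang (-θ)) {ν (.out v)} +
          ∑ e ∈ farEdges G u, edgeH (ν ∘ Wire.out) e)
        (∑ v ∈ nbrs G u, H (ν (.out u)) (ν (.out v)) +
          ∑ e ∈ symmDiff (farEdges G u) (pairs (nbrs G u)), edgeH (ν ∘ Wire.out) e) := by
  rw [← netEq_iff_derivable (hasOpenEnds_rotatedGraphState G u θ ν) (hasOpenEnds_graphState _ ν)]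
  have hrot := netEq_rotatedGraphState_nbrs (E := E) (G := G) (u := u) ν θ
  have hlc := netEq_graphState_localComplement (E := E) (G := G) (u := u) ν
  exact ⟨fun h => hrot.symm.trans (h.trans hlc), fun h => hrot.trans (h.trans hlc.symm)⟩

lemma IsEulerAngle.vanDenNest {θ : ℝ} (h : IsEulerAngle E (ang (-θ))) : VanDenNest E θ := by
  intro V _ G u ν
  rw [derivable_localComplement_iff]
  have hθ : ang θ = -ang (-θ) := by simp [ang]
  let F := ∑ e ∈ farEdges G u, edgeH (ν ∘ Wire.out) e
  have hstar := h.netEq_X_star (O := outs ν ∪ (wires F).toFinset) (o := ν (.out u))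
    (m := ν (.mid u)) (q := fun v => ν (.out v)) (l := nbrs G u) (by simp [F, apply_mem_outs])
    (by simp) (by simp)
  calc NetEq E (outs ν) _ (∑ v ∈ nbrs G u, H (ν (.out u)) (ν (.out v)) +
          ∑ e ∈ pairs (nbrs G u), edgeH (ν ∘ Wire.out) e + F) :=
        .within F (hθ ▸ hstar) rfl rfl
    NetEq E (outs ν) _ (∑ v ∈ nbrs G u, H (ν (.out u)) (ν (.out v)) +
        ∑ e ∈ symmDiff (farEdges G u) (pairs (nbrs G u)), edgeH (ν ∘ Wire.out) e) :=
      .within (∑ v ∈ nbrs G u, H (ν (.out u)) (ν (.out v)))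
        (netEq_edgeH_symmDiff (ν ∘ Wire.out) (farEdges G u) (pairs (nbrs G u)))
        (by simp only [F]; abel)

/-- The path `1 - 0 - 2`. -/
def pathGraph : SimpleGraph (Fin 3) where
  Adj v w := v ≠ w ∧ (v = 0 ∨ w = 0)
  symm := ⟨fun _ _ h => ⟨h.1.symm, h.2.symm⟩⟩
  loopless := ⟨fun _ h => h.1 rfl⟩

/-- Names for the wires of a graph state with three vertices, for which local complementation at
the vertex `0` becomes `PathComplementation`. -/
def pathNames : Wire (Fin 3) ↪ ℕ where
  toFun
    | .out v => v
    | .mid v => 3 + v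
    | .half v w => 6 + 3 * v + w
  inj' := by
    rintro (v | v | ⟨v, w⟩) (v' | v' | ⟨v', w'⟩) h <;> simp at h ⊢ <;> omega

lemma VanDenNest.pathComplementation {θ : ℝ} (h : VanDenNest E θ) :
    PathComplementation E (ang (-θ)) := by
  have hnbrs : nbrs pathGraph 0 = {1, 2} := by
    ext v
    fin_cases v <;> simp [pathGraph]
  have hfar : farEdges pathGraph 0 = ⊥ := by
    ext e
    induction e using Sym2.ind with
    | _ v w => simp [pathGraph]; grind
  have hpairs : pairs ({1, 2} : Finset (Fin 3)) = {s(1, 2)} := by decide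
  have houts : outs pathNames = {0, 1, 2} := by decide
  have hθ : ang θ = -ang (-θ) := by simp [ang]
  have key := (derivable_localComplement_iff _ _).1 (h _ pathGraph 0 pathNames)
  rw [hnbrs, hfar, hpairs, houts, hθ, bot_symmDiff] at key
  unfold PathComplementation
  simpa [pathNames, add_assoc] using key

theorem vanDenNest_iff_isEulerAngle {θ : ℝ} (hθ : ang (-θ) + ang (-θ) = ang Real.pi) :
    VanDenNest E θ ↔ IsEulerAngle E (ang (-θ)) :=
  ⟨fun h => h.pathComplementation.isEulerAngle hθ, IsEulerAngle.vanDenNest⟩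

end LocalComplement

/-! ### The Euler decomposition as an equation between diagrams -/

section EulerDecomposition

variable {E : Set Equation} {τ : Real.Angle}

lemma netEq_green_red_green (τ : Real.Angle) :
    NetEq E {0, 1} (Z τ {0, 2} + X τ {2, 3} + Z τ {3, 1}) (Z τ {0} + X τ {0, 1} + Z τ {1}) :=
  have hZ {O : Finset ℕ} (x y : ℕ) : NetEq E O (Z τ {x, y}) (Z τ {x} + L x y) := by
    simpa using netEq_Z_cons τ x {y}
  calc NetEq E {0, 1} (Z τ {0, 2} + X τ {2, 3} + Z τ {3, 1})
        (Z τ {2, 0} + X τ {2, 3} + Z τ {3, 1}) := .of_eq (by rw [Multiset.pair_comm 0])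
    NetEq E {0, 1} _ (Z τ {2} + L 2 0 + X τ {2, 3} + Z τ {3, 1}) :=
      .within (X τ {2, 3} + Z τ {3, 1}) (hZ 2 0)
    NetEq E {0, 1} _ (L 2 0 + (Z τ {2} + X τ {2, 3} + (Z τ {3} + L 3 1))) :=
      .within (L 2 0 + Z τ {2} + X τ {2, 3}) (hZ 3 1)
    NetEq E {0, 1} _ (Z τ {0} + X τ {0, 3} + (Z τ {3} + L 3 1)) :=
      netEq_subst (by decide) (by decide)
    NetEq E {0, 1} _ (L 3 1 + (Z τ {0} + X τ {0, 3} + Z τ {3})) := .of_eq (by abel)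
    NetEq E {0, 1} _ (Z τ {0} + X τ {0, 1} + Z τ {1}) := netEq_subst (by decide) (by decide)

lemma netEq_H_iff_derivable :
    NetEq E {0, 1} (H 0 1) (Z τ {0, 2} + X τ {2, 3} + Z τ {3, 1}) ↔
      Derivable E (H 0 1) (Z τ {0, 2} + X τ {2, 3} + Z τ {3, 1}) :=
  netEq_iff_derivable
    (hasOpenEnds_of_count (by simp) (by simp only [wires_H]; decide))
    (hasOpenEnds_of_count (by simp) (by simp only [wires_add, wires_Z, wires_X]; decide))

lemma injOn_val {l : List ℕ} (hl : l.Nodup) : Set.InjOn (val l) {n | n < l.length} := by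
  intro m hm n hn h
  rw [val, val, List.getD_eq_getElem _ _ hm, List.getD_eq_getElem _ _ hn] at h
  exact hl.getElem_inj_iff.1 h

lemma eulerDecomposition_iff :
    EulerDecomposition E ↔ IsEulerAngle E (ang (-(Real.pi / 2))) := by
  let τ := ang (-(Real.pi / 2))
  have hdiagram (x y a b : ℕ) : ({spider .green τ {a, x}, spider .red τ {x, y},
      spider .green τ {y, b}} : Net ℕ) = Z τ {a, x} + X τ {x, y} + Z τ {y, b} := by
    simp [Z, X, ← Multiset.singleton_add, add_assoc]
  have heuler : IsEulerAngle E τ ↔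
      Derivable E (H 0 1) (Z τ {0, 2} + X τ {2, 3} + Z τ {3, 1}) :=
    ⟨fun h => netEq_H_iff_derivable.1 (h.trans (netEq_green_red_green τ).symm),
      fun h => (netEq_H_iff_derivable.2 h).trans (netEq_green_red_green τ)⟩
  change EulerDecomposition E ↔ IsEulerAngle E τ
  rw [heuler]
  constructor
  · intro h
    have := h 0 1 2 3 (by decide)
    rwa [hdiagram] at this
  · intro h a b x y hd
    rw [hdiagram]
    change Derivable E (H a b) _
    simpa using derivable_rename h ((injOn_val hd).mono fun n hn => by simp at hn ⊢; omega)

lemma isEulerAngle_neg_iff : IsEulerAngle E (-τ) ↔ IsEulerAngle E τ :=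
  ⟨fun h => neg_neg τ ▸ h.neg, IsEulerAngle.neg⟩

lemma isEulerAngle_half_pi_iff :
    IsEulerAngle E (ang (Real.pi / 2)) ↔ EulerDecomposition E := by
  rw [eulerDecomposition_iff, ang, ang, Real.Angle.coe_neg, isEulerAngle_neg_iff]

lemma ang_half_pi_add_self : ang (Real.pi / 2) + ang (Real.pi / 2) = ang Real.pi := by
  rw [ang, ang, ← Real.Angle.coe_add, add_halves]

lemma ang_neg_half_pi_add_self : ang (-(Real.pi / 2)) + ang (-(Real.pi / 2)) = ang Real.pi := by
  rw [ang, ang, ← Real.Angle.coe_add, ← neg_add, add_halves, Real.Angle.coe_neg,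
    Real.Angle.neg_coe_pi]

end EulerDecomposition

end RedGreen

theorem mainTheorem1 (E : Set RedGreen.Equation) :
    (RedGreen.VanDenNest E (-(Real.pi / 2)) ↔ RedGreen.EulerDecomposition E) ∧
    (RedGreen.VanDenNest E (Real.pi / 2) ↔ RedGreen.EulerDecomposition E) := by
  constructor
  · rw [RedGreen.vanDenNest_iff_isEulerAngle (by
      simpa using RedGreen.ang_half_pi_add_self), neg_neg, RedGreen.isEulerAngle_half_pi_iff]
  · rw [RedGreen.vanDenNest_iff_isEulerAngle RedGreen.ang_neg_half_pi_add_self,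
      RedGreen.eulerDecomposition_iff]
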